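/- Consider the classical risk model with premium rate $1$ in which claims arrive according to a Poisson process of rate $\lambda>0$. Independently of everything else, a claim is distributed as $U^p$ with probability $1-\varepsilon$ and as $U^h$ with probability $\varepsilon$, where $\varepsilon\in(0,1)$. Here $U^p$ has a phase-type distribution (its distribution function is $1-\boldsymbol\pi\exp(\boldsymbol T x)\boldsymbol e$ for $x\ge 0$, where $\boldsymbol T$ is the sub-intensity matrix of a finite set of transient states, $\boldsymbol\pi$ an initial distribution on them and $\boldsymbol e$ the vector of ones), and $U^h\ge 0$ has finite mean. Let $\rho=\lambda\big((1-\varepsilon)\mathbb E U^p+\varepsilon\,\mathbb E U^h\big)$, and assume $\rho<1$. Put $\rho_d=(1-\varepsilon)\lambda\,\mathbb E U^p$, $\gamma_h=\lambda\,\mathbb E U^h$, $$p=\frac{\varepsilon\gamma_h}{1-\rho_d},\qquad q=\frac{1-\rho}{1-\rho_d}=1-p .$$ Let $F_e^h(u)=\int_0^u \mathbb P(U^h>x)\,dx/\mathbb E U^h$ be the stationary excess distribution of $U^h$, with tail $\overline F{}_e^h=1-F_e^h$. Assume that $F_e^h$ is subexponential: $\overline F{}_e^h>0$ everywhere and, for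 each $k\in\mathbb N$, the tail of the $k$-fold convolution of $F_e^h$ is asymptotically $k\,\overline F{}_e^h(u)$ as $u\to\infty$. Let $M_0,M_1,\dots$ be distributed as the supremum over $t\ge 0$ of the claim surplus process $\sum_{k=1}^{N^d_t}U^p_k-t$ in which claims distributed as $U^p$ arrive according to a Poisson process $N^d$ of rate $(1-\varepsilon)\lambda$. Let $B_1,B_2,\dots$ have distribution function $F_e^h$, and let $N$ be geometric, $\mathbb P(N=k)=q(1-q)^k$ for $k\ge 0$, with all these variables independent. For an integer $n\ge 1$ define $$V=M_0+M_1+B_1+\sum_{k=2}^{N+2}(M_k+B_k),\qquad \widehat V_n=\max\{B_1,\dots,B_{N+2}\}\,\mathbf 1_{\{N+2\le n\}},$$ $$X=p^2\,\mathbf 1_{\{V>u\}},\qquad Y=p^2\,\mathbf 1_{\{\widehat V_n>u\}},\qquad \mathbb E Y=q\sum_{k=2}^n p^k\,\mathbb P\big(\max\{B_1,\dots,B_k\}>u\big).$$ For $R\ge 2$ independent copies $(X_i,Y_i)$ of $(X,Y)$, let $\overline X,\overline Y$ be the empirical means and let $$\widehat\alpha=-\frac{\sum_{i=1}^R (X_i-\overline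 X)(Y_i-\overline Y)}{\sum_{i=1}^R (Y_i-\overline Y)^2},$$ with $\widehat\alpha=0$ if the denominator vanishes. The control-variate estimator is $$Z_{n,R}(u)=\overline X+\widehat\alpha\,(\overline Y-\mathbb E Y),$$ and the crude Monte Carlo estimator is $\overline X$. Theorem (variance reduction). For all fixed $n\ge 1$ and $R\ge 2$, as $u\to\infty$, $$\operatorname{Var}\big(Z_{n,R}(u)\big)\sim p^{\,n+3}\,\frac{1+nq}{q}\cdot\frac{\overline F{}_e^h(u)}{R} \qquad\text{and}\qquad \frac{\operatorname{Var}\big(Z_{n,R}(u)\big)}{\operatorname{Var}(\overline X)}\longrightarrow p^{\,n-1}\,\frac{1+nq}{1+q}.$$ -/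

import Mathlib

open MeasureTheory ProbabilityTheory Filter Topology Asymptotics

noncomputable section

namespace RuinCV

/-! ### Distribution classes -/

/-- The tail `u ↦ μ (u, ∞)` of a law `μ` on the real line. -/
def tail (μ : Measure ℝ) (u : ℝ) : ℝ := μ.real (Set.Ioi u)

/-- The `n`-fold convolution of a law on the real line. -/
def convPow (μ : Measure ℝ) : ℕ → Measure ℝ
  | 0 => Measure.dirac 0
  | n + 1 => (convPow μ n).conv μ

/-- Subexponential laws on `[0, ∞)`: the tail is everywhere positive and, for every `n`, the tail
of the `n`-fold convolution is asymptotically `n` times the tail of the law. -/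
structure IsSubexponential (μ : Measure ℝ) : Prop where
  isProbabilityMeasure : IsProbabilityMeasure μ
  nonneg : μ (Set.Iio 0) = 0
  tail_pos : ∀ u : ℝ, 0 < tail μ u
  tail_convPow : ∀ n : ℕ, Tendsto (fun u => tail (convPow μ n) u / tail μ u) atTop (𝓝 (n : ℝ))

/-- Phase-type laws. `T` is the sub-intensity matrix of the jump rates between the `d` transient
states (the rate from `i` into the absorbing state being `-∑ j, T i j`), and `π` is the initial
distribution on the transient states; mass missing from `π` sits in the absorbing state.
The distribution function is `F x = 1 - π exp (x T) e` for `x ≥ 0`, with `e` the vector of ones. -/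
def IsPhaseType (μ : Measure ℝ) : Prop :=
  IsProbabilityMeasure μ ∧ μ (Set.Iio 0) = 0 ∧
  ∃ (d : ℕ) (π : Fin d → ℝ) (T : Matrix (Fin d) (Fin d) ℝ),
    (∀ i, 0 ≤ π i) ∧ ∑ i, π i ≤ 1 ∧
    (∀ i j, i ≠ j → 0 ≤ T i j) ∧ (∀ i, ∑ j, T i j ≤ 0) ∧
    -- the states are transient
    (∀ i j, Tendsto (fun x : ℝ => NormedSpace.exp (x • T) i j) atTop (𝓝 0)) ∧
    ∀ x : ℝ, 0 ≤ x → tail μ x = ∑ i, ∑ j, π i * NormedSpace.exp (x • T) i j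

/-- The mean of a law on the real line. -/
def mean (μ : Measure ℝ) : ℝ := ∫ x, x ∂μ

/-- The stationary excess law of a law `μ` on `[0, ∞)`: it has the density
`x ↦ μ (x, ∞) / mean μ` on `(0, ∞)`. -/
def excessLaw (μ : Measure ℝ) : Measure ℝ :=
  (volume.restrict (Set.Ioi 0)).withDensity fun x => ENNReal.ofReal (tail μ x / mean μ)

/-! ### The claim surplus process of the classical risk model -/

/-- The number of claims up to time `t`, where `ω k` is the pair formed by the waiting time before
the `k`-th claim (`k = 0, 1, …`) and the size of that claim. -/
def claimCount (ω : ℕ → ℝ × ℝ) (t : ℝ) : ℕ :=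
  Set.ncard {k : ℕ | ∑ j ∈ Finset.range (k + 1), (ω j).1 ≤ t}

/-- The claim surplus process `t ↦ ∑_{k ≤ N(t)} U_k - t` (premium rate one). -/
def claimSurplus (ω : ℕ → ℝ × ℝ) (t : ℝ) : ℝ :=
  (∑ k ∈ Finset.range (claimCount ω t), (ω k).2) - t

/-- The law of the supremum over `t ∈ [0, ∞)` of the claim surplus process, when the claims arrive
according to a Poisson process of the given rate (independent exponential waiting times) and the
claim sizes are i.i.d. with law `μ` and independent of the arrivals. -/
def supSurplusLaw (rate : ℝ) (μ : Measure ℝ) : Measure ℝ :=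
  (Measure.infinitePi fun _ : ℕ => (expMeasure rate).prod μ).map
    fun ω => ⨆ t : NNReal, claimSurplus ω t

/-! ### The mixture model -/

/-- The classical risk model with mixture claim sizes: a claim is phase-type with probability
`1 - ε`, and is drawn from the second law with probability `ε`. -/
structure MixtureModel where
  /-- the Poisson arrival rate of the claims -/
  arrivalRate : ℝ
  /-- the probability that a claim is of the second (heavy-tailed) type -/
  ε : ℝ
  /-- the law of the phase-type claims -/
  phLaw : Measure ℝ
  /-- the law of the heavy-tailed claims -/
  htLaw : Measure ℝ
  arrivalRate_pos : 0 < arrivalRate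
  ε_pos : 0 < ε
  ε_lt_one : ε < 1
  phLaw_phaseType : IsPhaseType phLaw
  htLaw_prob : IsProbabilityMeasure htLaw
  htLaw_nonneg : htLaw (Set.Iio 0) = 0
  htLaw_integrable : Integrable (fun x : ℝ => x) htLaw
  /-- the safety loading condition -/
  safetyLoading :
    arrivalRate * mean (ENNReal.ofReal (1 - ε) • phLaw + ENNReal.ofReal ε • htLaw) < 1

namespace MixtureModel

variable (m : MixtureModel)

/-- The law of a claim. -/
def claimLaw : Measure ℝ :=
  ENNReal.ofReal (1 - m.ε) • m.phLaw + ENNReal.ofReal m.ε • m.htLaw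

/-- `ρ`, the expected aggregate claim size per unit time. -/
def ρ : ℝ := m.arrivalRate * mean m.claimLaw

/-- `ρ_d`, the expected aggregate claim size per unit time of the base model, in which the
heavy-tailed claims are discarded. -/
def ρd : ℝ := (1 - m.ε) * (m.arrivalRate * mean m.phLaw)

/-- `γ_h`, the arrival rate times the mean of the heavy-tailed claims. -/
def γh : ℝ := m.arrivalRate * mean m.htLaw

/-- `p = ε γ_h / (1 - ρ_d)`. -/
def p : ℝ := m.ε * m.γh / (1 - m.ρd)

/-- `q = (1 - ρ) / (1 - ρ_d)`. -/
def q : ℝ := (1 - m.ρ) / (1 - m.ρd)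

/-- The law of the supremum of the claim surplus process in the base model, where claims with the
phase-type law arrive at rate `(1 - ε)` times the original arrival rate. -/
def discardSupLaw : Measure ℝ := supSurplusLaw ((1 - m.ε) * m.arrivalRate) m.phLaw

/-- The stationary excess law of the heavy-tailed claims. -/
def htExcessLaw : Measure ℝ := excessLaw m.htLaw

/-- The `n`-th order approximation
`((1 - ρ) / (1 - ρ_d)) ∑_{k=2}^n p ^ k P (max (B_1, …, B_k) > u)`, where `B_1, B_2, …` are
i.i.d. heavy-tailed excesses. It is the expectation of the control variate. -/
def approx (n : ℕ) (u : ℝ) : ℝ :=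
  m.q * ∑ k ∈ Finset.Icc 2 n,
    m.p ^ k * (Measure.pi fun _ : Fin k => m.htExcessLaw).real {b | u < ⨆ j, b j}

end MixtureModel

/-! ### The simulated variables -/

/-- The labels of the random variables that enter `R` independent replications. -/
inductive SimIndex (R : ℕ) : Type
  | sup (i : Fin R) (k : ℕ)
  | excess (i : Fin R) (k : ℕ)
  | geom (i : Fin R)

variable {Ω : Type*} {R : ℕ}

/-- All the random variables that enter the simulation, as one real-valued family. -/
def simFamily (M B : Fin R → ℕ → Ω → ℝ) (N : Fin R → Ω → ℕ) : SimIndex R → Ω → ℝ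
  | .sup i k => M i k
  | .excess i k => B i k
  | .geom i => fun ω => (N i ω : ℝ)

/-- The input of `R` independent replications: in the `i`-th one, `M i 0, M i 1, …` are distributed
as the supremum in the base model, `B i 1, B i 2, …` as the heavy-tailed excess, and `N i` is
geometric on `{0, 1, …}` with success probability `q`; all these variables are independent. -/
structure IsSimulation [MeasurableSpace Ω] (m : MixtureModel) (P : Measure Ω)
    (M B : Fin R → ℕ → Ω → ℝ) (N : Fin R → Ω → ℕ) : Prop where
  law_sup : ∀ i k, HasLaw (M i k) m.discardSupLaw P
  law_excess : ∀ i k, HasLaw (B i k) m.htExcessLaw P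
  measurable_geom : ∀ i, Measurable (N i)
  law_geom : ∀ i k, P.real {ω | N i ω = k} = (1 - m.q) ^ k * m.q
  indep : iIndepFun (simFamily M B N) P

/-- One replication of `V = M_0 + M_1 + B_1 + ∑_{k=2}^{N+2} (M_k + B_k)`. -/
def V (M B : ℕ → Ω → ℝ) (N : Ω → ℕ) (ω : Ω) : ℝ :=
  M 0 ω + M 1 ω + B 1 ω + ∑ k ∈ Finset.Icc 2 (N ω + 2), (M k ω + B k ω)

/-- One replication of the truncated maximum `max (B_1, …, B_{N+2}) 1_{N + 2 ≤ n}`. -/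
def truncMax (n : ℕ) (B : ℕ → Ω → ℝ) (N : Ω → ℕ) (ω : Ω) : ℝ :=
  if N ω + 2 ≤ n then
    (Finset.Icc 1 (N ω + 2)).sup' (Finset.nonempty_Icc.2 (by omega)) fun k => B k ω
  else 0

/-- The target variable of the `i`-th replication, `X_i = p ^ 2 1_{V_i > u}`. -/
def target (m : MixtureModel) (M B : Fin R → ℕ → Ω → ℝ) (N : Fin R → Ω → ℕ) (u : ℝ)
    (i : Fin R) (ω : Ω) : ℝ :=
  m.p ^ 2 * Set.indicator {ω' | u < V (M i) (B i) (N i) ω'} 1 ω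

/-- The control variate of the `i`-th replication, `p ^ 2 1_{W_i > u}`, with `W_i` the truncated
maximum. -/
def control (m : MixtureModel) (n : ℕ) (B : Fin R → ℕ → Ω → ℝ) (N : Fin R → Ω → ℕ) (u : ℝ)
    (i : Fin R) (ω : Ω) : ℝ :=
  m.p ^ 2 * Set.indicator {ω' | u < truncMax n (B i) (N i) ω'} 1 ω

/-! ### The estimators -/

/-- The empirical mean. -/
def empMean (X : Fin R → Ω → ℝ) (ω : Ω) : ℝ := (∑ i, X i ω) / R

/-- The empirical control variate coefficient
`-∑ (X_i - X̄) (Y_i - Ȳ) / ∑ (Y_i - Ȳ) ^ 2`; it is `0` if all `Y_i` coincide. -/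
def empCoeff (X Y : Fin R → Ω → ℝ) (ω : Ω) : ℝ :=
  -((∑ i, (X i ω - empMean X ω) * (Y i ω - empMean Y ω)) / ∑ i, (Y i ω - empMean Y ω) ^ 2)

/-- The control variate estimator `X̄ + α (Ȳ - y)`, where `α` is the empirical coefficient and `y`
is the known expectation of the control variate. -/
def cvEstimator (X Y : Fin R → Ω → ℝ) (y : ℝ) (ω : Ω) : ℝ :=
  empMean X ω + empCoeff X Y ω * (empMean Y ω - y)

/-- The crude Monte Carlo estimator. -/
def crudeEst (m : MixtureModel) (M B : Fin R → ℕ → Ω → ℝ) (N : Fin R → Ω → ℕ) (u : ℝ) : Ω → ℝ :=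
  empMean (target m M B N u)

/-- The control variate estimator with the truncated maximum as control. -/
def cvEst (m : MixtureModel) (n : ℕ) (M B : Fin R → ℕ → Ω → ℝ) (N : Fin R → Ω → ℕ) (u : ℝ) :
    Ω → ℝ :=
  cvEstimator (target m M B N u) (control m n B N u) (m.approx n u)

end RuinCV

end

/-! Write `c = p ^ 2`, let `A i` be the event that the `i`-th target variable `V` exceeds `u`, `D i`
the event that its truncated maximum does, and `f u` the tail of the heavy-tailed excess law. By
nonnegativity `D i ⊆ A i` for `u ≥ 0`, and `P (A i)` is of order `f u → 0`. Since replications are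
independent, two successes at once have probability `O(f ^ 2)` and are negligible.

With no success the estimator is `0`. With exactly one success that the control misses, every `Y i`
is `0`, the coefficient is `0` and the estimator is `c / R`. With exactly one success that the
control catches, `Y = X`, the coefficient is exactly `-1`, and the estimator collapses to the
constant `approx n u`, which tends to `0`. Hence the second moment is `(c / R) ^ 2 * ∑ (P (A i) - P
(D i)) + o(f)`, and the squared mean is `O(f ^ 2)`. This is `cvEstimator_pointwise`, integrated in
`abs_variance_cvEstimator_sub_le`. Crude Monte Carlo is the case `D i = ∅`.

It remains to find the limits of `P (A i) / f` and `P (D i) / f`. Given `N = k`, `V` is a sum of `k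
+ 2` heavy excesses and of copies of `M`, whose exponentially small tail (`tail_supSurplusLaw_le`)
is invisible at the scale of `f`; so its tail is asymptotically `(k + 2) f`
(`IsSubexponential.tendsto_tail_conv`). Kesten's bound `IsSubexponential.tail_conv_convPow_le`
permits summation over `k`. The maximum of `k + 2` excesses has the same asymptotics. The first
limit is thus `∑ p ^ k q (k + 2) = (1 + q) / q`, the second is its part with `k + 2 ≤ n`, and the
difference is `p ^ (n - 1) (1 + n q) / q`. -/

namespace RuinCV

/-! ### Subexponential tails under convolution -/

section Tails

variable {μ ν ν' κ : Measure ℝ}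

lemma tail_nonneg (μ : Measure ℝ) (u : ℝ) : 0 ≤ tail μ u := measureReal_nonneg

lemma tail_le_one (μ : Measure ℝ) [IsProbabilityMeasure μ] (u : ℝ) : tail μ u ≤ 1 :=
  measureReal_le_one

lemma tail_antitone (μ : Measure ℝ) [IsFiniteMeasure μ] : Antitone (tail μ) := fun _ _ h =>
  measureReal_mono (Set.Ioi_subset_Ioi h)

lemma ofReal_tail (μ : Measure ℝ) [IsFiniteMeasure μ] (u : ℝ) :
    ENNReal.ofReal (tail μ u) = μ (Set.Ioi u) := by
  simp [tail, measureReal_def]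

lemma real_Iic_eq (μ : Measure ℝ) [IsProbabilityMeasure μ] (v : ℝ) :
    μ.real (Set.Iic v) = 1 - tail μ v := by
  rw [← Set.compl_Ioi, probReal_compl_eq_one_sub measurableSet_Ioi, tail]

lemma real_Ici_zero [IsProbabilityMeasure μ] (hμ : μ (Set.Iio 0) = 0) :
    μ.real (Set.Ici 0) = 1 := by
  rw [← Set.compl_Iio, probReal_compl_eq_one_sub measurableSet_Iio, measureReal_def, hμ]; simp

lemma real_Ioc_eq (μ : Measure ℝ) [IsFiniteMeasure μ] {a b : ℝ} (h : a ≤ b) :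
    μ.real (Set.Ioc a b) = tail μ a - tail μ b := by
  have : Set.Ioc a b = Set.Ioi a \ Set.Ioi b := by ext; simp
  rw [this, measureReal_sdiff (Set.Ioi_subset_Ioi h) measurableSet_Ioi]; rfl

lemma real_Icc_zero [IsProbabilityMeasure μ] (hμ : μ (Set.Iio 0) = 0) {v : ℝ} (hv : 0 ≤ v) :
    μ.real (Set.Icc 0 v) = 1 - tail μ v := by
  have : Set.Icc 0 v = Set.Ici 0 \ Set.Ioi v := by ext; simp
  rw [this, measureReal_sdiff _ measurableSet_Ioi, real_Ici_zero hμ]; · rfl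
  exact fun x hx => hv.trans (le_of_lt hx)

lemma tendsto_tail_atTop (μ : Measure ℝ) [IsProbabilityMeasure μ] :
    Tendsto (tail μ) atTop (𝓝 0) := by
  have h := (tendsto_cdf_atTop μ).const_sub 1
  refine (h.congr fun v => ?_).trans (by simp)
  rw [cdf_eq_real, real_Iic_eq]; ring

lemma tail_conv (μ ν : Measure ℝ) [IsProbabilityMeasure μ] [IsProbabilityMeasure ν] (u : ℝ) :
    tail (μ.conv ν) u = (μ.prod ν).real {z | u < z.1 + z.2} := by
  rw [tail, Measure.conv, map_measureReal_apply (by fun_prop) measurableSet_Ioi]; rfl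

lemma conv_Iio_zero [IsProbabilityMeasure μ] [IsProbabilityMeasure ν] (hμ : μ (Set.Iio 0) = 0)
    (hν : ν (Set.Iio 0) = 0) : (μ.conv ν) (Set.Iio 0) = 0 := by
  rw [Measure.conv, Measure.map_apply (by fun_prop) measurableSet_Iio]
  refine measure_mono_null (t := Set.Iio 0 ×ˢ Set.univ ∪ Set.univ ×ˢ Set.Iio 0) ?_ ?_
  · intro z hz
    simp only [Set.mem_preimage, Set.mem_Iio, Set.mem_union, Set.mem_prod, Set.mem_univ] at *
    by_contra! h
    have := h.1; have := h.2; simp at *; linarith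
  · simp [Measure.prod_prod, hμ, hν]

instance isProbabilityMeasure_convPow (μ : Measure ℝ) [IsProbabilityMeasure μ] (n : ℕ) :
    IsProbabilityMeasure (convPow μ n) := by
  induction n with
  | zero => unfold convPow; infer_instance
  | succ n ih => unfold convPow; infer_instance

lemma convPow_Iio_zero [IsProbabilityMeasure μ] (hμ : μ (Set.Iio 0) = 0) (n : ℕ) :
    (convPow μ n) (Set.Iio 0) = 0 := by
  induction n with
  | zero => simp [convPow]
  | succ n ih => exact conv_Iio_zero ih hμ

lemma prod_real_le_of_section [IsFiniteMeasure μ] [IsFiniteMeasure ν] [IsFiniteMeasure ν']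
    {K : ℝ} (hK : 0 ≤ K) {E : Set (ℝ × ℝ)} (hE : MeasurableSet E)
    (h : ∀ x, ν.real {y | (x, y) ∈ E} ≤ K * ν'.real {y | (x, y) ∈ E}) :
    (μ.prod ν).real E ≤ K * (μ.prod ν').real E := by
  have key : (μ.prod ν) E ≤ ENNReal.ofReal K * (μ.prod ν') E := by
    rw [Measure.prod_apply hE, Measure.prod_apply hE,
      ← lintegral_const_mul _ (measurable_measure_prodMk_left hE)]
    refine lintegral_mono fun x => ?_
    have := ENNReal.ofReal_le_ofReal (h x)
    rw [ENNReal.ofReal_mul hK] at this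
    simpa [measureReal_def, Set.preimage] using this
  have h2 := ENNReal.toReal_mono (by finiteness) key
  simpa [measureReal_def, hK] using h2

lemma prod_real_swap [IsFiniteMeasure μ] [IsFiniteMeasure ν] {E : Set (ℝ × ℝ)}
    (hE : MeasurableSet E) :
    (μ.prod ν).real E = (ν.prod μ).real {z | (z.2, z.1) ∈ E} := by
  rw [← Measure.prod_swap, map_measureReal_apply measurable_swap hE]; rfl

/-- Both coordinates exceed `v` and their sum exceeds `u`. -/
def jointSet (v u : ℝ) : Set (ℝ × ℝ) := {z | v < z.1 ∧ v < z.2 ∧ u < z.1 + z.2}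

lemma measurableSet_jointSet (v u : ℝ) : MeasurableSet (jointSet v u) := by
  refine (measurableSet_lt (g := Prod.fst) measurable_const measurable_fst).inter
    ((measurableSet_lt measurable_const measurable_snd).inter
      (measurableSet_lt measurable_const (measurable_fst.add measurable_snd)))

lemma jointSet_section (v u x : ℝ) : {y | (x, y) ∈ jointSet v u} =
    if v < x then Set.Ioi (max v (u - x)) else ∅ := by
  ext y
  split_ifs with h
  · simp [jointSet, h, sub_lt_iff_lt_add']
  · simp [jointSet, h]

/-- Sections of `jointSet v u` are empty or half-lines starting at or beyond `v`, so a comparison of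
tails beyond `v` is enough. -/
lemma prod_jointSet_le [IsFiniteMeasure μ] [IsFiniteMeasure ν] [IsFiniteMeasure ν']
    {K v : ℝ} (hK : 0 ≤ K) (h : ∀ x, v ≤ x → tail ν x ≤ K * tail ν' x) (u : ℝ) :
    (μ.prod ν).real (jointSet v u) ≤ K * (μ.prod ν').real (jointSet v u) := by
  refine prod_real_le_of_section hK (measurableSet_jointSet v u) fun x => ?_
  rw [jointSet_section]
  split_ifs
  · exact h _ (le_max_left _ _)
  · simp

lemma prod_jointSet_swap [IsFiniteMeasure μ] [IsFiniteMeasure ν] (v u : ℝ) :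
    (μ.prod ν).real (jointSet v u) = (ν.prod μ).real (jointSet v u) := by
  rw [prod_real_swap (measurableSet_jointSet v u)]
  congr 1
  ext z
  simp only [jointSet, Set.mem_ofPred_eq]
  rw [add_comm]; tauto

/-- If the sum exceeds `u` and one summand is at most `v`, the other exceeds `u - v`. -/
lemma tail_conv_le [IsProbabilityMeasure μ] [IsProbabilityMeasure ν] (v u : ℝ) :
    tail (μ.conv ν) u ≤ tail ν (u - v) + tail μ (u - v) + (μ.prod ν).real (jointSet v u) := by
  rw [tail_conv]
  have hsub : {z : ℝ × ℝ | u < z.1 + z.2} ⊆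
      (Set.univ ×ˢ Set.Ioi (u - v) ∪ Set.Ioi (u - v) ×ˢ Set.univ) ∪ jointSet v u := by
    intro z hz
    simp only [Set.mem_ofPred_eq] at hz
    simp only [Set.mem_union, Set.mem_prod, Set.mem_univ, Set.mem_Ioi, jointSet, Set.mem_ofPred_eq]
    by_cases h1 : v < z.1
    · by_cases h2 : v < z.2
      · exact Or.inr ⟨h1, h2, hz⟩
      · exact Or.inl (Or.inr ⟨by linarith, trivial⟩)
    · exact Or.inl (Or.inl ⟨trivial, by linarith⟩)
  refine (measureReal_mono hsub).trans ((measureReal_union_le _ _).trans ?_)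
  gcongr
  refine (measureReal_union_le _ _).trans ?_
  simp [measureReal_prod_prod, tail]

/-- Three disjoint ways to exceed `u`: one summand in `[0, v]` and the other above `u` (twice), or
both above `v`. Used for `μ = ν`, it bounds the joint part from above. -/
lemma le_tail_conv [IsProbabilityMeasure μ] [IsProbabilityMeasure ν] (hμ : μ (Set.Iio 0) = 0)
    (hν : ν (Set.Iio 0) = 0) {v u : ℝ} (hv : 0 ≤ v) (hvu : v ≤ u) :
    (1 - tail μ v) * tail ν u + tail μ u * (1 - tail ν v) + (μ.prod ν).real (jointSet v u) ≤
      tail (μ.conv ν) u := by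
  rw [tail_conv, ← real_Icc_zero hμ hv, ← real_Icc_zero hν hv]
  unfold tail
  rw [← measureReal_prod_prod, ← measureReal_prod_prod, ← measureReal_union, ← measureReal_union]
  · refine measureReal_mono ?_
    rintro z ((⟨⟨h1, h2⟩, h3⟩ | ⟨h1, h2, h3⟩) | ⟨h1, h2, h3⟩)
    · simp only [Set.mem_Ioi, Set.mem_ofPred_eq] at *; linarith
    · simp only [Set.mem_Ioi, Set.mem_ofPred_eq] at *; linarith
    · exact h3
  · rw [Set.disjoint_left]
    rintro z (⟨⟨h1, h2⟩, h3⟩ | ⟨h1, h2, h3⟩) ⟨h4, h5, h6⟩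
    · linarith
    · linarith
  · exact measurableSet_jointSet v u
  · rw [Set.disjoint_left]
    rintro z ⟨⟨h1, h2⟩, h3⟩ ⟨h4, h5, h6⟩
    simp only [Set.mem_Ioi] at *; linarith
  · exact measurableSet_Ioi.prod measurableSet_Icc

lemma IsSubexponential.tendsto_tail_conv_self (h : IsSubexponential μ) :
    Tendsto (fun u => tail (μ.conv μ) u / tail μ u) atTop (𝓝 2) := by
  have := h.isProbabilityMeasure
  simpa [convPow] using h.tail_convPow 2

/-- Subexponential laws are long-tailed. -/
lemma IsSubexponential.tendsto_tail_sub (h : IsSubexponential μ) {y : ℝ} (hy : 0 ≤ y) :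
    Tendsto (fun u => tail μ (u - y) / tail μ u) atTop (𝓝 1) := by
  have := h.isProbabilityMeasure
  -- Split by the first summand: above `u`; in `[0, y]` with the second above `u`; in `(y, u]` with
  -- the second above `u - y`. Solved for `tail μ (u - y)`, this gives an upper bound, and the limit
  -- `2` of the convolution ratio makes it tight.
  have lower : ∀ᶠ u in atTop, tail μ u + (1 - tail μ y) * tail μ u +
      (tail μ y - tail μ u) * tail μ (u - y) ≤ tail (μ.conv μ) u := by
    filter_upwards [eventually_ge_atTop y] with u hu
    rw [tail_conv, ← real_Icc_zero h.nonneg hy, ← real_Ioc_eq μ hu]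
    conv_lhs => enter [1, 1]; rw [← mul_one (tail μ u), ← real_Ici_zero h.nonneg]
    unfold tail
    rw [← measureReal_prod_prod, ← measureReal_prod_prod, ← measureReal_prod_prod,
      ← measureReal_union, ← measureReal_union]
    · refine measureReal_mono ?_
      rintro z ((⟨h1, h2⟩ | ⟨⟨h1, h2⟩, h3⟩) | ⟨⟨h1, h2⟩, h3⟩) <;>
        · simp only [Set.mem_Ioi, Set.mem_ofPred_eq, Set.mem_Ici] at *; linarith
    · rw [Set.disjoint_left]
      rintro z (⟨h1, h2⟩ | ⟨⟨h1, h2⟩, h3⟩) ⟨⟨h4, h5⟩, h6⟩ <;>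
        · simp only [Set.mem_Ioi] at *; linarith
    · exact measurableSet_Ioc.prod measurableSet_Ioi
    · rw [Set.disjoint_left]
      rintro z ⟨h1, h2⟩ ⟨⟨h4, h5⟩, h6⟩
      simp only [Set.mem_Ioi] at *; linarith
    · exact measurableSet_Icc.prod measurableSet_Ioi
  have htail := tendsto_tail_atTop μ
  have hlim : Tendsto (fun u => (tail (μ.conv μ) u / tail μ u - 2 + tail μ y) /
      (tail μ y - tail μ u)) atTop (𝓝 1) := by
    have := ((h.tendsto_tail_conv_self.sub_const 2).add_const (tail μ y)).div
      (htail.const_sub (tail μ y)) (by simpa using (h.tail_pos y).ne')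
    refine (this.congr fun u => rfl).trans ?_
    simp [(h.tail_pos y).ne']
  refine tendsto_of_tendsto_of_tendsto_of_le_of_le' tendsto_const_nhds hlim ?_ ?_
  · refine Eventually.of_forall fun u => ?_
    rw [one_le_div (h.tail_pos u)]
    exact tail_antitone μ (by linarith)
  · filter_upwards [lower, htail.eventually_lt_const (h.tail_pos y)] with u hu hlt
    have hF := h.tail_pos u
    rw [le_div_iff₀ (by linarith), div_mul_eq_mul_div, div_le_iff₀ hF]
    have : (tail (μ.conv μ) u / tail μ u - 2 + tail μ y) * tail μ u =
        tail (μ.conv μ) u - 2 * tail μ u + tail μ y * tail μ u := by field_simp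
    rw [this]; linarith

/-- The tail of a law, relative to the tail of a subexponential law, is additive under
convolution. -/
lemma IsSubexponential.tendsto_tail_conv (h : IsSubexponential μ) [IsProbabilityMeasure ν]
    [IsProbabilityMeasure κ] (hν : ν (Set.Iio 0) = 0) (hκ : κ (Set.Iio 0) = 0) {a b : ℝ}
    (ha : Tendsto (fun u => tail ν u / tail μ u) atTop (𝓝 a))
    (hb : Tendsto (fun u => tail κ u / tail μ u) atTop (𝓝 b)) :
    Tendsto (fun u => tail (ν.conv κ) u / tail μ u) atTop (𝓝 (a + b)) := by
  have := h.isProbabilityMeasure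
  obtain ⟨K, hK, v₀, hKν, hKκ⟩ : ∃ K : ℝ, 0 ≤ K ∧ ∃ v₀ : ℝ,
      (∀ x, v₀ ≤ x → tail ν x ≤ K * tail μ x) ∧ (∀ x, v₀ ≤ x → tail κ x ≤ K * tail μ x) := by
    have h1 := ha.eventually_le_const (show a < max (max a b + 1) 0 from
      lt_max_of_lt_left (by linarith [le_max_left a b]))
    have h2 := hb.eventually_le_const (show b < max (max a b + 1) 0 from
      lt_max_of_lt_left (by linarith [le_max_right a b]))
    obtain ⟨v₀, hv₀⟩ := eventually_atTop.1 (h1.and h2)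
    refine ⟨max (max a b + 1) 0, le_max_right _ _, v₀, fun x hx => ?_, fun x hx => ?_⟩
    · exact (div_le_iff₀ (h.tail_pos x)).1 (hv₀ x hx).1
    · exact (div_le_iff₀ (h.tail_pos x)).1 (hv₀ x hx).2
  have shift : ∀ {η : Measure ℝ} {c v : ℝ}, 0 ≤ v →
      Tendsto (fun u => tail η u / tail μ u) atTop (𝓝 c) →
      Tendsto (fun u => tail η (u - v) / tail μ u) atTop (𝓝 c) := by
    intro η c v hv hη
    have h1 : Tendsto (fun u : ℝ => u - v) atTop atTop :=
      tendsto_atTop_add_const_right _ (-v) tendsto_id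
    have := (hη.comp h1).mul (h.tendsto_tail_sub hv)
    rw [mul_one] at this
    refine this.congr fun u => ?_
    simp only [Function.comp]
    rw [div_mul_div_cancel₀ (h.tail_pos _).ne']
  -- When both summands exceed `v`, each law is traded for `μ` at the cost of a factor `K`. For `μ`
  -- itself, the joint part is what remains of the tail of `μ.conv μ` after the two single-jump
  -- contributions, about `2 * tail μ v` relative to `tail μ u`.
  have upper : ∀ v, max v₀ 0 ≤ v → ∀ u, v ≤ u → tail (ν.conv κ) u / tail μ u ≤
      tail κ (u - v) / tail μ u + tail ν (u - v) / tail μ u +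
        K * K * (tail (μ.conv μ) u / tail μ u - 2 * (1 - tail μ v)) := by
    intro v hv u hu
    have hv0 : 0 ≤ v := (le_max_right _ _).trans hv
    have hvv : v₀ ≤ v := (le_max_left _ _).trans hv
    have hF := h.tail_pos u
    have e1 := tail_conv_le (μ := ν) (ν := κ) v u
    have e2 : (ν.prod κ).real (jointSet v u) ≤ K * (ν.prod μ).real (jointSet v u) :=
      prod_jointSet_le hK (fun x hx => hKκ x (hvv.trans hx)) u
    have e3 : (μ.prod ν).real (jointSet v u) ≤ K * (μ.prod μ).real (jointSet v u) :=
      prod_jointSet_le hK (fun x hx => hKν x (hvv.trans hx)) u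
    rw [prod_jointSet_swap] at e3
    have e4 := le_tail_conv h.nonneg h.nonneg hv0 hu
    have e5 : (ν.prod κ).real (jointSet v u) ≤
        K * K * (tail (μ.conv μ) u - 2 * (1 - tail μ v) * tail μ u) := by
      refine e2.trans ?_
      rw [mul_assoc]
      refine mul_le_mul_of_nonneg_left (e3.trans ?_) hK
      refine mul_le_mul_of_nonneg_left ?_ hK
      linarith
    rw [div_le_iff₀ hF]
    calc _ ≤ _ := e1.trans (add_le_add_right e5 _)
      _ = _ := by field_simp
  have lower : ∀ v, 0 ≤ v → ∀ u, v ≤ u →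
      (1 - tail ν v) * (tail κ u / tail μ u) + (tail ν u / tail μ u) * (1 - tail κ v) ≤
        tail (ν.conv κ) u / tail μ u := by
    intro v hv u hu
    have e1 := le_tail_conv hν hκ hv hu
    have : 0 ≤ (ν.prod κ).real (jointSet v u) := measureReal_nonneg
    rw [le_div_iff₀ (h.tail_pos u)]
    have hF := (h.tail_pos u).ne'
    calc _ = (1 - tail ν v) * tail κ u + tail ν u * (1 - tail κ v) := by field_simp
      _ ≤ _ := by linarith
  -- For fixed `v` both bounds have limits in `u`, and these limits tend to `a + b` as `v` grows; so
  -- `v` is fixed first, close enough for the given `c`.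
  refine tendsto_order.2 ⟨fun c hc => ?_, fun c hc => ?_⟩
  · have hv : Tendsto (fun v => (1 - tail ν v) * b + a * (1 - tail κ v)) atTop (𝓝 (a + b)) := by
      have := (((tendsto_tail_atTop ν).const_sub 1).mul_const b).add
        (((tendsto_tail_atTop κ).const_sub 1).const_mul a)
      convert this using 2; ring
    obtain ⟨v, hv1, hv2⟩ := ((hv.eventually_const_lt hc).and (eventually_ge_atTop 0)).exists
    have hl := (hb.const_mul (1 - tail ν v)).add (ha.mul_const (1 - tail κ v))
    filter_upwards [hl.eventually_const_lt hv1, eventually_ge_atTop v] with u h1 h2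
    exact h1.trans_le (lower v hv2 u h2)
  · have hv : Tendsto (fun v => b + a + K * K * (2 - 2 * (1 - tail μ v))) atTop (𝓝 (a + b)) := by
      have := (((((tendsto_tail_atTop μ).const_sub 1).const_mul 2).const_sub 2).const_mul
        (K * K)).const_add (b + a)
      convert this using 2; ring
    obtain ⟨v, hv1, hv2⟩ := ((hv.eventually_lt_const hc).and
      (eventually_ge_atTop (max v₀ 0))).exists
    have hv0 : 0 ≤ v := (le_max_right _ _).trans hv2
    have hl := ((shift hv0 hb).add (shift hv0 ha)).add
      ((h.tendsto_tail_conv_self.sub_const (2 * (1 - tail μ v))).const_mul (K * K))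
    filter_upwards [hl.eventually_lt_const hv1, eventually_ge_atTop v] with u h1 h2
    exact (upper v hv2 u h2).trans_lt h1

lemma tendsto_tail_dirac_zero_div (μ : Measure ℝ) :
    Tendsto (fun u => tail (Measure.dirac 0) u / tail μ u) atTop (𝓝 0) := by
  refine tendsto_const_nhds.congr' ?_
  filter_upwards [eventually_ge_atTop 0] with u hu
  simp [tail, measureReal_def, hu]

lemma IsSubexponential.tendsto_tail_conv_convPow (h : IsSubexponential μ) [IsProbabilityMeasure ν]
    [IsProbabilityMeasure κ] (hν : ν (Set.Iio 0) = 0) (hκ : κ (Set.Iio 0) = 0) {a b : ℝ}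
    (ha : Tendsto (fun u => tail ν u / tail μ u) atTop (𝓝 a))
    (hb : Tendsto (fun u => tail κ u / tail μ u) atTop (𝓝 b)) (n : ℕ) :
    Tendsto (fun u => tail (κ.conv (convPow ν n)) u / tail μ u) atTop (𝓝 (b + n * a)) := by
  refine h.tendsto_tail_conv hκ (convPow_Iio_zero hν n) hb ?_
  induction n with
  | zero => simpa [convPow] using tendsto_tail_dirac_zero_div μ
  | succ n ih =>
    have := h.tendsto_tail_conv (convPow_Iio_zero hν n) hν ih ha
    rw [convPow]
    convert this using 2
    push_cast; ring

/-- If `tail ν ≤ K tail μ` on `[0, ∞)`, then replacing the second summand changes the tail of a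
sum by a factor of at most `K`, up to the tail of the first summand. -/
lemma tail_conv_le_mul [IsProbabilityMeasure μ] [IsProbabilityMeasure ν] [IsProbabilityMeasure κ]
    (hμ : μ (Set.Iio 0) = 0) {K : ℝ} (hK : 0 ≤ K) (h : ∀ x, 0 ≤ x → tail ν x ≤ K * tail μ x)
    (u : ℝ) :
    tail (κ.conv ν) u ≤ tail κ u + K * (tail (κ.conv μ) u - tail κ u) := by
  set E : Set (ℝ × ℝ) := {z | z.1 ≤ u ∧ u < z.1 + z.2} with hE
  have hEm : MeasurableSet E := (measurableSet_le measurable_fst measurable_const).inter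
    (measurableSet_lt measurable_const (measurable_fst.add measurable_snd))
  have h1 : (κ.prod ν).real E ≤ K * (κ.prod μ).real E := by
    refine prod_real_le_of_section hK hEm fun x => ?_
    by_cases hx : x ≤ u
    · have : {y | (x, y) ∈ E} = Set.Ioi (u - x) := by
        ext y; simp [hE, hx, sub_lt_iff_lt_add']
      rw [this]
      exact h _ (by linarith)
    · simp [hE, hx]
  have h2 : tail κ u + (κ.prod μ).real E ≤ tail (κ.conv μ) u := by
    rw [tail_conv]
    conv_lhs => rw [← mul_one (tail κ u), ← real_Ici_zero hμ]
    unfold tail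
    rw [← measureReal_prod_prod, ← measureReal_union]
    · refine measureReal_mono ?_
      rintro z (⟨h1, h2⟩ | ⟨h1, h2⟩)
      · simp only [Set.mem_Ioi, Set.mem_ofPred_eq, Set.mem_Ici] at *; linarith
      · exact h2
    · rw [Set.disjoint_left]
      rintro z ⟨h1, h2⟩ ⟨h4, h5⟩
      simp only [Set.mem_Ioi] at *; linarith
    · exact hEm
  have h3 : tail (κ.conv ν) u ≤ tail κ u + (κ.prod ν).real E := by
    rw [tail_conv]
    have : tail κ u = (κ.prod ν).real (Set.Ioi u ×ˢ Set.univ) := by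
      simp [measureReal_prod_prod, tail]
    rw [this]
    refine (measureReal_mono ?_).trans (measureReal_union_le _ _)
    intro z hz
    by_cases hx : z.1 ≤ u
    · exact Or.inr ⟨hx, hz⟩
    · exact Or.inl ⟨not_le.1 hx, trivial⟩
  calc _ ≤ tail κ u + K * (κ.prod μ).real E := h3.trans (add_le_add_right h1 _)
    _ ≤ _ := by gcongr; linarith

/-- Far out the ratio is near its limit; before that, `tail ν ≤ 1` and `tail μ` is bounded below by
monotonicity. -/
lemma IsSubexponential.tail_le_mul (h : IsSubexponential μ) [IsProbabilityMeasure ν] {a : ℝ}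
    (ha : Tendsto (fun u => tail ν u / tail μ u) atTop (𝓝 a)) :
    ∃ K : ℝ, 0 ≤ K ∧ ∀ x, tail ν x ≤ K * tail μ x := by
  have := h.isProbabilityMeasure
  obtain ⟨v, hv⟩ := eventually_atTop.1 (ha.eventually_le_const (lt_add_one a))
  have hpos := h.tail_pos v
  refine ⟨max (a + 1) (1 / tail μ v), le_max_of_le_right (by positivity), fun x => ?_⟩
  rcases le_total v x with hx | hx
  · have := (div_le_iff₀ (h.tail_pos x)).1 (hv x hx)
    refine this.trans (mul_le_mul_of_nonneg_right (le_max_left _ _) (h.tail_pos x).le)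
  · calc tail ν x ≤ 1 := tail_le_one _ _
      _ = 1 / tail μ v * tail μ v := by field_simp
      _ ≤ _ := mul_le_mul (le_max_right _ _) (tail_antitone μ hx) hpos.le
        (le_max_of_le_right (by positivity))

/-- Kesten's bound. -/
lemma IsSubexponential.tail_conv_convPow_le (h : IsSubexponential μ) [IsProbabilityMeasure ν]
    [IsProbabilityMeasure κ] (hν : ν (Set.Iio 0) = 0) {b δ : ℝ}
    (ha : Tendsto (fun u => tail ν u / tail μ u) atTop (𝓝 1))
    (hb : Tendsto (fun u => tail κ u / tail μ u) atTop (𝓝 b)) (hδ : 0 < δ) :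
    ∃ C : ℝ, 0 ≤ C ∧ ∀ (n : ℕ) (u : ℝ), 0 ≤ u →
      tail (κ.conv (convPow ν n)) u ≤ C * (1 + δ) ^ n * tail μ u := by
  have := h.isProbabilityMeasure
  obtain ⟨K₁, hK₁, h1⟩ := h.tail_le_mul ha
  obtain ⟨K₂, hK₂, h2⟩ := h.tail_le_mul hb
  -- The increment `tail (ν.conv μ) - tail ν` is asymptotically `tail μ`. It is the factor by which
  -- the constant grows when one more `ν` is convolved in.
  have hlim := (h.tendsto_tail_conv hν h.nonneg ha
    (tendsto_const_nhds.congr fun u => (div_self (h.tail_pos u).ne').symm)).sub ha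
  obtain ⟨v, hv⟩ := eventually_atTop.1
    (hlim.eventually_le_const (show (1 : ℝ) + 1 - 1 < 1 + δ by linarith))
  have hpos := h.tail_pos v
  set A : ℝ := K₁ + 1 / tail μ v with hA
  have hA0 : 0 ≤ A := by positivity
  -- The bracket solves the recursion `a ↦ A + (1 + δ) * a` started at `K₂`.
  have key : ∀ (n : ℕ), ∀ u, 0 ≤ u → tail (κ.conv (convPow ν n)) u ≤
      ((K₂ + A / δ) * (1 + δ) ^ n - A / δ) * tail μ u := by
    intro n
    induction n with
    | zero => intro u _; simpa [convPow] using h2 u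
    | succ n ih =>
      intro u hu
      set a : ℝ := (K₂ + A / δ) * (1 + δ) ^ n - A / δ with ha'
      have ha0 : 0 ≤ a := by
        have : (1 : ℝ) ≤ (1 + δ) ^ n := one_le_pow₀ (by linarith)
        have : (K₂ + A / δ) * 1 ≤ (K₂ + A / δ) * (1 + δ) ^ n := by gcongr
        linarith
      have e1 : (K₂ + A / δ) * (1 + δ) ^ (n + 1) - A / δ = A + (1 + δ) * a := by
        rw [ha', pow_succ]; field_simp; ring
      rw [e1]
      have hF := h.tail_pos u
      rcases le_total v u with hvu | hvu
      · have e2 := tail_conv_le_mul (κ := ν) (ν := κ.conv (convPow ν n)) h.nonneg ha0 ih u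
        have e3 : κ.conv (convPow ν (n + 1)) = ν.conv (κ.conv (convPow ν n)) := by
          rw [convPow, ← Measure.conv_assoc, Measure.conv_comm]
        rw [e3]
        have e4 := hv u hvu
        rw [← sub_div, div_le_iff₀ hF] at e4
        have e5 := h1 u
        have e6 : K₁ * tail μ u ≤ A * tail μ u := by
          gcongr; rw [hA]; linarith [show 0 ≤ 1 / tail μ v by positivity]
        have e7 := mul_le_mul_of_nonneg_left e4 ha0
        calc _ ≤ _ := e2
          _ ≤ K₁ * tail μ u + a * ((1 + δ) * tail μ u) := add_le_add e5 e7
          _ ≤ A * tail μ u + a * ((1 + δ) * tail μ u) := by gcongr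
          _ = _ := by ring
      -- Before `v` the asymptotics say nothing; the term `1 / tail μ v` of `A` absorbs the trivial
      -- bound.
      · calc tail _ u ≤ 1 := tail_le_one _ _
          _ = 1 / tail μ v * tail μ v := by field_simp
          _ ≤ A * tail μ u := mul_le_mul (by linarith) (tail_antitone μ hvu) hpos.le hA0
          _ ≤ (A + (1 + δ) * a) * tail μ u := by
            gcongr; linarith [show 0 ≤ (1 + δ) * a by positivity]
  refine ⟨K₂ + A / δ, by positivity, fun n u hu => (key n u hu).trans ?_⟩
  refine mul_le_mul_of_nonneg_right ?_ (tail_nonneg μ u)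
  linarith [show 0 ≤ A / δ by positivity]

/-- The tail of a subexponential law decays more slowly than any exponential function. -/
lemma IsSubexponential.tendsto_exp_div_tail (h : IsSubexponential μ) {θ : ℝ} (hθ : 0 < θ) :
    Tendsto (fun u => Real.exp (-θ * u) / tail μ u) atTop (𝓝 0) := by
  have := h.isProbabilityMeasure
  have hlt : (1 : ℝ) < Real.exp (θ / 2) := by simpa using hθ
  obtain ⟨v, hv⟩ := eventually_atTop.1
    ((h.tendsto_tail_sub zero_le_one).eventually_le_const hlt)
  -- Beyond `v` a unit shift costs at most `exp (θ / 2)`, so the tail decays at most at rate `θ /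
  -- 2`, slower than `exp (-θ * u)`.
  have step : ∀ k : ℕ, tail μ v ≤ Real.exp (θ / 2 * k) * tail μ (v + k) := by
    intro k
    induction k with
    | zero => simp
    | succ k ih =>
      have h1 := hv (v + (k + 1)) (by linarith [Nat.cast_nonneg (α := ℝ) k])
      rw [div_le_iff₀ (h.tail_pos _), show v + (k + 1) - 1 = v + (k : ℝ) by ring] at h1
      calc _ ≤ _ := ih
        _ ≤ Real.exp (θ / 2 * k) * (Real.exp (θ / 2) * tail μ (v + (k + 1))) := by gcongr
        _ = _ := by rw [← mul_assoc, ← Real.exp_add]; push_cast; ring_nf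
  have hpos := h.tail_pos v
  have bound : ∀ u, v ≤ u → Real.exp (-θ * u) / tail μ u ≤
      Real.exp (θ / 2 * (1 - v)) / tail μ v * Real.exp (-(θ / 2) * u) := by
    intro u hu
    have hk := step ⌈u - v⌉₊
    have h1 : u - v ≤ ⌈u - v⌉₊ := Nat.le_ceil _
    have h2 : (⌈u - v⌉₊ : ℝ) < u - v + 1 := Nat.ceil_lt_add_one (by linarith)
    have h3 : tail μ v ≤ Real.exp (θ / 2 * (u - v + 1)) * tail μ u := hk.trans (mul_le_mul
      (Real.exp_le_exp.2 (by gcongr)) (tail_antitone μ (by linarith)) (tail_nonneg μ _)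
      (Real.exp_pos _).le)
    rw [div_le_iff₀ (h.tail_pos u)]
    calc Real.exp (-θ * u) = Real.exp (-θ * u) / tail μ v * tail μ v := by field_simp
      _ ≤ Real.exp (-θ * u) / tail μ v * (Real.exp (θ / 2 * (u - v + 1)) * tail μ u) := by gcongr
      _ = (Real.exp (-θ * u) * Real.exp (θ / 2 * (u - v + 1))) / tail μ v * tail μ u := by ring
      _ = (Real.exp (θ / 2 * (1 - v)) * Real.exp (-(θ / 2) * u)) / tail μ v * tail μ u := by
        rw [← Real.exp_add, ← Real.exp_add]; ring_nf
      _ = _ := by ring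
  have hexp : Tendsto (fun u => Real.exp (θ / 2 * (1 - v)) / tail μ v * Real.exp (-(θ / 2) * u))
      atTop (𝓝 0) := by
    rw [← mul_zero (Real.exp (θ / 2 * (1 - v)) / tail μ v)]
    refine Tendsto.const_mul _ (Real.tendsto_exp_atBot.comp ?_)
    exact (tendsto_const_mul_atBot_of_neg (by linarith)).2 tendsto_id
  refine squeeze_zero' (Eventually.of_forall fun u => ?_) ?_ hexp
  · exact div_nonneg (Real.exp_pos _).le (tail_nonneg _ _)
  · filter_upwards [eventually_ge_atTop v] with u hu using bound u hu

end Tails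
-- Exponential decay of the supremum of the claim surplus
section SupSurplus

lemma ae_nonneg_of_Iio_zero {μ : Measure ℝ} (hμ : μ (Set.Iio 0) = 0) : ∀ᵐ x ∂μ, 0 ≤ x := by
  rw [ae_iff]
  simpa [Set.Iio] using hμ

lemma expMeasure_Iio_zero (r : ℝ) : expMeasure r (Set.Iio 0) = 0 := by
  rw [expMeasure, gammaMeasure, withDensity_apply _ measurableSet_Iio]
  exact lintegral_gammaPDF_of_nonpos le_rfl

/-- Exponential tilting turns the density of rate `r` into `r / (r + θ)` times the density of rate
`r + θ`. -/
lemma lintegral_exp_neg_mul_expMeasure {r θ : ℝ} (hr : 0 < r) (hθ : 0 ≤ θ) :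
    ∫⁻ x, ENNReal.ofReal (Real.exp (-θ * x)) ∂(expMeasure r) = ENNReal.ofReal (r / (r + θ)) := by
  have hpdf : Measurable (gammaPDF 1 r) := (measurable_gammaPDFReal 1 r).ennreal_ofReal
  rw [expMeasure, gammaMeasure, lintegral_withDensity_eq_lintegral_mul _ hpdf (by fun_prop)]
  have : ∀ x, (gammaPDF 1 r * fun x => ENNReal.ofReal (Real.exp (-θ * x))) x =
      ENNReal.ofReal (r / (r + θ)) * gammaPDF 1 (r + θ) x := by
    intro x
    rw [Pi.mul_apply]
    rcases lt_or_ge x 0 with hx | hx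
    · simp [gammaPDF_of_neg hx]
    · rw [gammaPDF_of_nonneg hx, gammaPDF_of_nonneg hx, ← ENNReal.ofReal_mul (by positivity),
        ← ENNReal.ofReal_mul (by positivity)]
      congr 1
      have h1 : Real.exp (-((r + θ) * x)) = Real.exp (-(r * x)) * Real.exp (-θ * x) := by
        rw [← Real.exp_add]; ring_nf
      have : r + θ ≠ 0 := by positivity
      rw [h1]
      simp only [Real.Gamma_one, sub_self, Real.rpow_zero, Real.rpow_one]
      field_simp
  have hpdf' : Measurable (gammaPDF 1 (r + θ)) :=
    (measurable_gammaPDFReal 1 (r + θ)).ennreal_ofReal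
  rw [lintegral_congr this, lintegral_const_mul _ hpdf',
    lintegral_gammaPDF_eq_one one_pos (by positivity), mul_one]

lemma integrable_exp_neg_mul_expMeasure {r θ : ℝ} (hr : 0 < r) (hθ : 0 ≤ θ) :
    Integrable (fun x => Real.exp (-θ * x)) (expMeasure r) := by
  refine ⟨by fun_prop, ?_⟩
  rw [hasFiniteIntegral_iff_ofReal (Eventually.of_forall fun x => (Real.exp_pos _).le),
    lintegral_exp_neg_mul_expMeasure hr hθ]
  exact ENNReal.ofReal_lt_top

lemma integral_exp_neg_mul_expMeasure {r θ : ℝ} (hr : 0 < r) (hθ : 0 ≤ θ) :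
    ∫ x, Real.exp (-θ * x) ∂(expMeasure r) = r / (r + θ) := by
  rw [integral_eq_lintegral_of_nonneg_ae (Eventually.of_forall fun x => (Real.exp_pos _).le)
    (by fun_prop), lintegral_exp_neg_mul_expMeasure hr hθ, ENNReal.toReal_ofReal (by positivity)]

/-- The gain of the claim surplus over the first `n` claims. -/
def surplusWalk (ω : ℕ → ℝ × ℝ) (n : ℕ) : ℝ := ∑ k ∈ Finset.range n, ((ω k).2 - (ω k).1)

/-- The waiting times of the claims counted by time `t` add up to at most `t`, so the walk at that
claim count dominates the surplus. -/
lemma exists_lt_surplusWalk {ω : ℕ → ℝ × ℝ} (h1 : ∀ k, 0 ≤ (ω k).1) {u t : ℝ} (hu : 0 ≤ u)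
    (ht : 0 ≤ t) (h : u < claimSurplus ω t) : ∃ n, u < surplusWalk ω n := by
  refine ⟨claimCount ω t, h.trans_le ?_⟩
  rw [claimSurplus, surplusWalk, Finset.sum_sub_distrib]
  refine sub_le_sub_left ?_ _
  -- A count of `0` also arises as the `ncard` of an infinite set; in either case the surplus is `-t
  -- ≤ 0 ≤ u`.
  rcases hn : claimCount ω t with _ | n
  · rw [claimSurplus, hn] at h
    simp at h; linarith
  have hmem : n ∈ {k : ℕ | ∑ j ∈ Finset.range (k + 1), (ω j).1 ≤ t} := by
    by_contra hnot
    have hsub : {k : ℕ | ∑ j ∈ Finset.range (k + 1), (ω j).1 ≤ t} ⊆ ↑(Finset.range n) := by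
      intro k hk
      rw [Finset.coe_range, Set.mem_Iio]
      by_contra hkn
      refine hnot (le_trans (Finset.sum_le_sum_of_subset_of_nonneg ?_ fun j _ _ => h1 j) hk)
      exact Finset.range_mono (by omega)
    have := Set.ncard_le_ncard hsub (Finset.finite_toSet _)
    rw [Set.ncard_coe_finset, Finset.card_range] at this
    have hn' : Set.ncard {k : ℕ | ∑ j ∈ Finset.range (k + 1), (ω j).1 ≤ t} = n + 1 := hn
    omega
  exact hmem

lemma iSup_claimSurplus_nonneg {ω : ℕ → ℝ × ℝ} (h2 : ∀ k, 0 ≤ (ω k).2) :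
    0 ≤ ⨆ t : NNReal, claimSurplus ω t := by
  by_cases hb : BddAbove (Set.range fun t : NNReal => claimSurplus ω t)
  · refine le_trans ?_ (le_ciSup hb 0)
    simpa [claimSurplus] using Finset.sum_nonneg fun k _ => h2 k
  -- An unbounded path has supremum `0` by convention.
  · rw [Real.iSup_of_not_bddAbove hb]

/-- A negative drift admits an exponential moment below one. -/
lemma exists_mgf_mul_lt_one {μ : Measure ℝ} [IsProbabilityMeasure μ] {r : ℝ} (hr : 0 < r)
    (hint : 0 ∈ interior (integrableExpSet id μ)) (hmean : r * mean μ < 1) :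
    ∃ θ > 0, θ ∈ integrableExpSet id μ ∧ mgf id μ θ * (r / (r + θ)) < 1 := by
  have hd : HasDerivAt (mgf id μ) (mean μ) 0 := by
    simpa [mean] using hasDerivAt_mgf hint
  -- The functions `mgf id μ θ` and `1 + θ / r` agree at `0`, and `hmean` says that the first has
  -- the smaller slope there.
  have hd2 : HasDerivAt (fun θ => mgf id μ θ - θ / r) (mean μ - 1 / r) 0 :=
    hd.sub ((hasDerivAt_id (0 : ℝ)).div_const r)
  have hneg : mean μ - 1 / r < 0 := by
    rw [sub_neg, lt_div_iff₀ hr]; linarith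
  have h1 := (hasDerivAt_iff_tendsto_slope.1 hd2).eventually_lt_const hneg
  have h2 : ∀ᶠ θ in 𝓝[>] (0 : ℝ), slope (fun θ => mgf id μ θ - θ / r) 0 θ < 0 :=
    h1.filter_mono (nhdsWithin_mono _ fun x hx => ne_of_gt hx)
  have h3 : ∀ᶠ θ in 𝓝[>] (0 : ℝ), θ ∈ interior (integrableExpSet id μ) :=
    nhdsWithin_le_nhds (isOpen_interior.mem_nhds hint)
  obtain ⟨θ, ⟨h4, h5⟩, h6⟩ := ((h2.and h3).and self_mem_nhdsWithin).exists
  have h6 : 0 < θ := h6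
  refine ⟨θ, h6, interior_subset h5, ?_⟩
  rw [slope_def_field, div_lt_iff₀ (by linarith)] at h4
  simp only [mgf_zero, zero_div, sub_zero, zero_mul, sub_neg] at h4
  rw [← mul_div_assoc, div_lt_one (by positivity)]
  have : mgf id μ θ < 1 + θ / r := by linarith
  calc mgf id μ θ * r < (1 + θ / r) * r := by gcongr
    _ = r + θ := by field_simp

/-- Lundberg's inequality, with an unspecified constant. -/
lemma tail_supSurplusLaw_le {μ : Measure ℝ} [IsProbabilityMeasure μ] {r : ℝ} (hr : 0 < r)
    (hint : 0 ∈ interior (integrableExpSet id μ)) (hmean : r * mean μ < 1)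
    (hmeas : AEMeasurable (fun ω : ℕ → ℝ × ℝ => ⨆ t : NNReal, claimSurplus ω t)
      (Measure.infinitePi fun _ : ℕ => (expMeasure r).prod μ)) :
    ∃ θ > 0, ∃ C : ℝ, ∀ u, 0 ≤ u → tail (supSurplusLaw r μ) u ≤ C * Real.exp (-θ * u) := by
  have := isProbabilityMeasure_expMeasure hr
  obtain ⟨θ, hθ, hθint, hlt⟩ := exists_mgf_mul_lt_one hr hint hmean
  set φ := mgf id μ θ * (r / (r + θ)) with hφ
  have hφ0 : 0 ≤ φ := mul_nonneg mgf_nonneg (by positivity)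
  refine ⟨θ, hθ, 1 / (1 - φ), fun u hu => ?_⟩
  set P := Measure.infinitePi fun _ : ℕ => (expMeasure r).prod μ with hP
  have hexp : ∀ z : ℝ × ℝ, Real.exp (θ * (z.2 - z.1)) =
      Real.exp (-θ * z.1) * Real.exp (θ * z.2) := by
    intro z; rw [← Real.exp_add]; ring_nf
  have hmp : ∀ k, MeasurePreserving (fun ω : ℕ → ℝ × ℝ => ω k) P ((expMeasure r).prod μ) :=
    fun k => measurePreserving_eval_infinitePi _ k
  have hXint : ∀ k, Integrable (fun ω : ℕ → ℝ × ℝ => Real.exp (θ * ((ω k).2 - (ω k).1))) P := by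
    intro k
    have h0 : Integrable (fun z : ℝ × ℝ => Real.exp (θ * (z.2 - z.1)))
        ((expMeasure r).prod μ) := by
      simp_rw [hexp]
      exact (integrable_exp_neg_mul_expMeasure hr hθ.le).mul_prod hθint
    exact (hmp k).integrable_comp_of_integrable h0
  have hXmgf : ∀ k, mgf (fun ω : ℕ → ℝ × ℝ => (ω k).2 - (ω k).1) P θ = φ := by
    intro k
    have h1 : mgf (fun ω : ℕ → ℝ × ℝ => (ω k).2 - (ω k).1) P θ =
        ∫ z, Real.exp (θ * (z.2 - z.1)) ∂((expMeasure r).prod μ) := by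
      rw [← (hmp k).map_eq, integral_map (hmp k).aemeasurable (by fun_prop)]
      rfl
    rw [h1]
    simp_rw [hexp]
    rw [integral_prod_mul (fun x => Real.exp (-θ * x)) (fun y => Real.exp (θ * y)),
      integral_exp_neg_mul_expMeasure hr hθ.le, hφ, mul_comm]
    rfl
  have hindep : iIndepFun (fun (k : ℕ) (ω : ℕ → ℝ × ℝ) => (ω k).2 - (ω k).1) P :=
    iIndepFun_infinitePi (X := fun (_ : ℕ) (z : ℝ × ℝ) => z.2 - z.1) (by fun_prop)
  have hXmeas : ∀ k : ℕ, Measurable (fun ω : ℕ → ℝ × ℝ => (ω k).2 - (ω k).1) := by fun_prop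
  -- Chernoff's bound. Since `φ < 1`, these bounds are summable in `n`, and a union bound replaces
  -- any stopping argument.
  have hwalk : ∀ n, P {ω | u < surplusWalk ω n} ≤
      ENNReal.ofReal (Real.exp (-θ * u) * φ ^ n) := by
    intro n
    have hS : (surplusWalk · n) =
        ∑ k ∈ Finset.range n, fun ω : ℕ → ℝ × ℝ => (ω k).2 - (ω k).1 := by
      ext ω; simp [surplusWalk]
    have hI := hindep.integrable_exp_mul_sum hXmeas (s := Finset.range n) fun k _ => hXint k
    rw [← hS] at hI
    have h1 := measure_ge_le_exp_mul_mgf (X := (surplusWalk · n)) u hθ.le hI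
    rw [hS, hindep.mgf_sum hXmeas, Finset.prod_congr rfl fun k _ => hXmgf k, Finset.prod_const,
      Finset.card_range] at h1
    rw [← ENNReal.ofReal_toReal (measure_ne_top P _)]
    refine ENNReal.ofReal_le_ofReal (le_trans ?_ h1)
    refine measureReal_mono fun ω (hω : u < surplusWalk ω n) => ?_
    exact hω.le
  have hae : ∀ᵐ ω ∂P, ∀ k, 0 ≤ (ω k).1 := by
    rw [ae_all_iff]
    intro k
    have h1 : MeasurePreserving (fun ω : ℕ → ℝ × ℝ => (ω k).1) P (expMeasure r) :=
      measurePreserving_fst.comp (hmp k)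
    exact h1.quasiMeasurePreserving.ae (ae_nonneg_of_Iio_zero (expMeasure_Iio_zero r))
  have hsum : HasSum (fun n => Real.exp (-θ * u) * φ ^ n) (Real.exp (-θ * u) * (1 - φ)⁻¹) :=
    (hasSum_geometric_of_lt_one hφ0 hlt).mul_left _
  have hle : P {ω | u < ⨆ t : NNReal, claimSurplus ω t} ≤
      ENNReal.ofReal (Real.exp (-θ * u) * (1 - φ)⁻¹) := by
    calc P {ω | u < ⨆ t : NNReal, claimSurplus ω t} ≤ P (⋃ n, {ω | u < surplusWalk ω n}) := by
          refine measure_mono_ae ?_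
          filter_upwards [hae] with ω hω hlt'
          obtain ⟨t, ht⟩ := exists_lt_of_lt_ciSup hlt'
          obtain ⟨n, hn⟩ := exists_lt_surplusWalk hω hu t.2 ht
          exact Set.mem_iUnion.2 ⟨n, hn⟩
      _ ≤ ∑' n, P {ω | u < surplusWalk ω n} := measure_iUnion_le _
      _ ≤ ∑' n, ENNReal.ofReal (Real.exp (-θ * u) * φ ^ n) := ENNReal.tsum_le_tsum hwalk
      _ = _ := by
        rw [← ENNReal.ofReal_tsum_of_nonneg (fun n => by positivity) hsum.summable, hsum.tsum_eq]
  have h1φ : 0 < 1 - φ := by linarith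
  rw [tail, measureReal_def, supSurplusLaw,
    Measure.map_apply_of_aemeasurable hmeas measurableSet_Ioi]
  refine ENNReal.toReal_le_of_le_ofReal (by positivity) (hle.trans_eq ?_)
  congr 1
  rw [one_div, mul_comm]

lemma supSurplusLaw_Iio_zero {μ : Measure ℝ} [IsProbabilityMeasure μ] {r : ℝ} (hr : 0 < r)
    (hμ : μ (Set.Iio 0) = 0)
    (hmeas : AEMeasurable (fun ω : ℕ → ℝ × ℝ => ⨆ t : NNReal, claimSurplus ω t)
      (Measure.infinitePi fun _ : ℕ => (expMeasure r).prod μ)) :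
    supSurplusLaw r μ (Set.Iio 0) = 0 := by
  have := isProbabilityMeasure_expMeasure hr
  rw [supSurplusLaw, Measure.map_apply_of_aemeasurable hmeas measurableSet_Iio]
  have hae : ∀ᵐ ω ∂(Measure.infinitePi fun _ : ℕ => (expMeasure r).prod μ), ∀ k, 0 ≤ (ω k).2 := by
    rw [ae_all_iff]
    intro k
    have h1 : MeasurePreserving (fun ω : ℕ → ℝ × ℝ => (ω k).2)
        (Measure.infinitePi fun _ : ℕ => (expMeasure r).prod μ) μ :=
      measurePreserving_snd.comp (measurePreserving_eval_infinitePi _ k)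
    exact h1.quasiMeasurePreserving.ae (ae_nonneg_of_Iio_zero hμ)
  refine measure_mono_null ?_ (ae_iff.1 hae)
  intro ω hω h2
  exact absurd (iSup_claimSurplus_nonneg h2) (not_le.2 hω)

end SupSurplus

/-! ### Exponential moments of phase-type laws -/

section PhaseType

lemma abs_sum_pow_le {d : ℕ} {E : Matrix (Fin d) (Fin d) ℝ} {r : ℝ}
    (hE : ∀ i, ∑ j, |E i j| ≤ r) (k : ℕ) (i : Fin d) : ∑ j, |(E ^ k) i j| ≤ r ^ k := by
  induction k generalizing i with
  | zero =>
    simp only [pow_zero]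
    rw [Finset.sum_eq_single i] <;> simp +contextual [eq_comm]
  | succ k ih =>
    have hr : 0 ≤ r := (Finset.sum_nonneg fun j _ => abs_nonneg _).trans (hE i)
    rw [pow_succ', pow_succ']
    calc ∑ j, |(E * E ^ k) i j| ≤ ∑ j, ∑ l, |E i l| * |(E ^ k) l j| := by
          gcongr with j
          rw [Matrix.mul_apply]
          refine (Finset.abs_sum_le_sum_abs _ _).trans_eq ?_
          simp [abs_mul]
      _ = ∑ l, |E i l| * ∑ j, |(E ^ k) l j| := by
          rw [Finset.sum_comm]; simp_rw [Finset.mul_sum]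
      _ ≤ ∑ l, |E i l| * r ^ k := by gcongr with l; exact ih l
      _ = (∑ l, |E i l|) * r ^ k := by rw [Finset.sum_mul]
      _ ≤ _ := by gcongr; exact hE i

/-- Transience brings all absolute row sums of `exp (x₀ • T)` below `1 / 2` for some `x₀`, and the
semigroup property makes the decay geometric along multiples of `x₀`. -/
lemma IsPhaseType.exists_tail_le {μ : Measure ℝ} (h : IsPhaseType μ) :
    ∃ x₀ > 0, ∀ k : ℕ, tail μ (k * x₀) ≤ (1 / 2) ^ k := by
  obtain ⟨-, -, d, π, T, hπ, hπ1, -, -, hT, htail⟩ := h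
  have hlim : ∀ i, Tendsto (fun x : ℝ => ∑ j, |NormedSpace.exp (x • T) i j|) atTop (𝓝 0) := by
    intro i
    have := tendsto_finsetSum Finset.univ fun j _ => (hT i j).abs
    simpa using this
  have hev : ∀ᶠ x : ℝ in atTop, ∀ i, ∑ j, |NormedSpace.exp (x • T) i j| ≤ 1 / 2 :=
    eventually_all.2 fun i => (hlim i).eventually_le_const (by norm_num)
  obtain ⟨x₀, hx, hx₀⟩ := (hev.and (eventually_gt_atTop 0)).exists
  refine ⟨x₀, hx₀, fun k => ?_⟩
  have hpow : NormedSpace.exp (((k : ℝ) * x₀) • T) = NormedSpace.exp (x₀ • T) ^ k := by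
    rw [← Matrix.exp_nsmul, mul_smul, Nat.cast_smul_eq_nsmul]
  rw [htail _ (by positivity), hpow]
  calc ∑ i, ∑ j, π i * (NormedSpace.exp (x₀ • T) ^ k) i j
      ≤ ∑ i, π i * ∑ j, |(NormedSpace.exp (x₀ • T) ^ k) i j| := by
        gcongr with i
        rw [Finset.mul_sum]
        gcongr with j
        · exact hπ i
        · exact le_abs_self _
    _ ≤ ∑ i, π i * (1 / 2) ^ k := by
        gcongr with i
        · exact hπ i
        · exact abs_sum_pow_le hx k i
    _ = (∑ i, π i) * (1 / 2) ^ k := by rw [Finset.sum_mul]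
    _ ≤ 1 * (1 / 2) ^ k := by gcongr
    _ = _ := one_mul _

lemma zero_mem_interior_integrableExpSet {μ : Measure ℝ} [IsProbabilityMeasure μ]
    (hμ : μ (Set.Iio 0) = 0) {x₀ : ℝ} (hx₀ : 0 < x₀)
    (h : ∀ k : ℕ, tail μ (k * x₀) ≤ (1 / 2) ^ k) : 0 ∈ interior (integrableExpSet id μ) := by
  -- Chosen so that `exp (θ * x₀) = 3 / 2`: against a tail halving over each `x₀`, the series has
  -- ratio `3 / 4`.
  set θ := Real.log (3 / 2) / x₀ with hθ
  have hθ0 : 0 < θ := div_pos (Real.log_pos (by norm_num)) hx₀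
  have hexp : ∀ k : ℕ, Real.exp (θ * (k * x₀)) = (3 / 2) ^ k := by
    intro k
    rw [show θ * (k * x₀) = k * Real.log (3 / 2) by rw [hθ]; field_simp, Real.exp_nat_mul,
      Real.exp_log (by norm_num)]
  have hae := ae_nonneg_of_Iio_zero hμ
  have hpt : ∀ x : ℝ, 0 ≤ x → ENNReal.ofReal (Real.exp (θ * x)) ≤
      1 + ∑' k : ℕ, (Set.Ioi ((k : ℝ) * x₀)).indicator
        (fun _ => ENNReal.ofReal ((3 / 2) ^ (k + 1))) x := by
    intro x hx
    rcases hx.eq_or_lt with rfl | hx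
    · simp
    refine le_trans ?_ le_add_self
    have hc : 0 < ⌈x / x₀⌉₊ := Nat.ceil_pos.2 (by positivity)
    obtain ⟨k, hk⟩ := Nat.exists_eq_succ_of_ne_zero hc.ne'
    refine le_trans ?_ (ENNReal.le_tsum k)
    have h1 : (k : ℝ) * x₀ < x := by
      rw [← lt_div_iff₀ hx₀]
      exact Nat.lt_ceil.1 (by omega)
    have h2 : x ≤ ((k + 1 : ℕ) : ℝ) * x₀ := by
      rw [← div_le_iff₀ hx₀, ← Nat.succ_eq_add_one, ← hk]
      exact Nat.le_ceil _
    rw [Set.indicator_of_mem (by exact h1), ← hexp]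
    exact ENNReal.ofReal_le_ofReal (Real.exp_le_exp.2 (by gcongr))
  have hfin : ∫⁻ x, ENNReal.ofReal (Real.exp (θ * x)) ∂μ < ⊤ := by
    calc ∫⁻ x, ENNReal.ofReal (Real.exp (θ * x)) ∂μ
        ≤ ∫⁻ x, (1 + ∑' k : ℕ, (Set.Ioi ((k : ℝ) * x₀)).indicator
          (fun _ => ENNReal.ofReal ((3 / 2) ^ (k + 1))) x) ∂μ :=
          lintegral_mono_ae (hae.mono hpt)
      _ = 1 + ∑' k : ℕ, ENNReal.ofReal ((3 / 2) ^ (k + 1)) * μ (Set.Ioi ((k : ℝ) * x₀)) := by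
          rw [lintegral_add_left measurable_const, lintegral_tsum]
          · simp [lintegral_indicator_const measurableSet_Ioi]
          · exact fun k => (measurable_const.indicator measurableSet_Ioi).aemeasurable
      _ ≤ 1 + ∑' k : ℕ, ENNReal.ofReal (3 / 2 * (3 / 4) ^ k) := by
          gcongr with k
          rw [← ofReal_tail, ← ENNReal.ofReal_mul (by positivity)]
          refine ENNReal.ofReal_le_ofReal ?_
          calc (3 / 2 : ℝ) ^ (k + 1) * tail μ (k * x₀) ≤ (3 / 2) ^ (k + 1) * (1 / 2) ^ k := by
                gcongr; exact h k
            _ = _ := by rw [pow_succ, mul_right_comm, ← mul_pow, mul_comm]; norm_num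
      _ < ⊤ := by
          have hs : Summable fun k : ℕ => (3 / 2 : ℝ) * (3 / 4) ^ k :=
            (summable_geometric_of_lt_one (by norm_num) (by norm_num)).mul_left _
          exact ENNReal.add_lt_top.2 ⟨ENNReal.one_lt_top, hs.tsum_ofReal_lt_top⟩
  have hsub : Set.Iio θ ⊆ integrableExpSet id μ := by
    intro t ht
    have hI : Integrable (fun x => Real.exp (θ * x)) μ := by
      refine ⟨by fun_prop, ?_⟩
      rwa [hasFiniteIntegral_iff_ofReal (Eventually.of_forall fun x => (Real.exp_pos _).le)]
    refine hI.mono' (by fun_prop) ?_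
    filter_upwards [hae] with x hx
    rw [Real.norm_of_nonneg (Real.exp_pos _).le]
    exact Real.exp_le_exp.2 (mul_le_mul_of_nonneg_right (le_of_lt ht) hx)
  exact interior_maximal hsub isOpen_Iio hθ0

lemma IsPhaseType.zero_mem_interior_integrableExpSet {μ : Measure ℝ} (h : IsPhaseType μ) :
    0 ∈ interior (integrableExpSet id μ) := by
  have := h.1
  obtain ⟨x₀, hx₀, hx⟩ := h.exists_tail_le
  exact RuinCV.zero_mem_interior_integrableExpSet h.2.1 hx₀ hx

end PhaseType

/-! ### Parameters of the mixture model -/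

namespace MixtureModel

variable (m : MixtureModel)

lemma integrable_phLaw : Integrable (fun x : ℝ => x) m.phLaw :=
  integrable_of_mem_interior_integrableExpSet (X := id)
    m.phLaw_phaseType.zero_mem_interior_integrableExpSet

lemma mean_claimLaw : mean m.claimLaw = (1 - m.ε) * mean m.phLaw + m.ε * mean m.htLaw := by
  unfold mean claimLaw
  have h1 := m.ε_pos
  have h2 := m.ε_lt_one
  rw [integral_add_measure (m.integrable_phLaw.smul_measure ENNReal.ofReal_ne_top)
    (m.htLaw_integrable.smul_measure ENNReal.ofReal_ne_top), integral_smul_measure,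
    integral_smul_measure, ENNReal.toReal_ofReal (by linarith), ENNReal.toReal_ofReal h1.le]
  rfl

lemma ρ_eq : m.ρ = m.ρd + m.ε * m.γh := by
  rw [ρ, mean_claimLaw, ρd, γh]; ring

lemma γh_nonneg : 0 ≤ m.γh :=
  mul_nonneg m.arrivalRate_pos.le
    (integral_nonneg_of_ae (ae_nonneg_of_Iio_zero m.htLaw_nonneg))

lemma ρ_lt_one : m.ρ < 1 := m.safetyLoading

lemma ρd_lt_one : m.ρd < 1 := by
  have h1 := m.ρ_lt_one
  have h2 := mul_nonneg m.ε_pos.le m.γh_nonneg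
  rw [ρ_eq] at h1
  linarith

lemma one_sub_q : 1 - m.q = m.p := by
  have h : 1 - m.ρd ≠ 0 := (sub_pos.2 m.ρd_lt_one).ne'
  rw [q, p, ρ_eq]
  field_simp
  ring

lemma q_pos : 0 < m.q := div_pos (sub_pos.2 m.ρ_lt_one) (sub_pos.2 m.ρd_lt_one)

/-- If the heavy-tailed mean were `0`, division by zero would make the excess density vanish, and
the excess law would not be a probability. -/
lemma p_pos [IsProbabilityMeasure m.htExcessLaw] : 0 < m.p := by
  refine div_pos (mul_pos m.ε_pos (m.γh_nonneg.lt_of_ne' fun h0 => ?_))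
    (sub_pos.2 m.ρd_lt_one)
  have h1 : mean m.htLaw = 0 := (mul_eq_zero.1 h0).resolve_left m.arrivalRate_pos.ne'
  have h2 : m.htExcessLaw Set.univ = 0 := by simp [htExcessLaw, excessLaw, h1]
  simp at h2

lemma p_lt_one : m.p < 1 := by linarith [m.one_sub_q, m.q_pos]

/-- `Measure.map` of a function that is not a.e. measurable is `0`, so measurability of the supremum
is read off from its law having mass one. -/
lemma aemeasurable_of_isProbabilityMeasure {r : ℝ} {μ : Measure ℝ}
    [IsProbabilityMeasure (supSurplusLaw r μ)] :
    AEMeasurable (fun ω : ℕ → ℝ × ℝ => ⨆ t : NNReal, claimSurplus ω t)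
      (Measure.infinitePi fun _ : ℕ => (expMeasure r).prod μ) :=
  AEMeasurable.of_map_ne_zero (IsProbabilityMeasure.ne_zero (supSurplusLaw r μ))

lemma discard_rate_pos : 0 < (1 - m.ε) * m.arrivalRate :=
  mul_pos (sub_pos.2 m.ε_lt_one) m.arrivalRate_pos

lemma discardSupLaw_Iio_zero [IsProbabilityMeasure m.discardSupLaw] :
    m.discardSupLaw (Set.Iio 0) = 0 := by
  have := m.phLaw_phaseType.1
  have : IsProbabilityMeasure (supSurplusLaw ((1 - m.ε) * m.arrivalRate) m.phLaw) :=
    inferInstanceAs (IsProbabilityMeasure m.discardSupLaw)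
  exact supSurplusLaw_Iio_zero m.discard_rate_pos m.phLaw_phaseType.2.1
    aemeasurable_of_isProbabilityMeasure

/-- The supremum in the base model has a lighter tail than the heavy-tailed excess. -/
lemma tendsto_tail_discardSupLaw (hsub : IsSubexponential m.htExcessLaw)
    [IsProbabilityMeasure m.discardSupLaw] :
    Tendsto (fun u => tail m.discardSupLaw u / tail m.htExcessLaw u) atTop (𝓝 0) := by
  have := m.phLaw_phaseType.1
  have : IsProbabilityMeasure (supSurplusLaw ((1 - m.ε) * m.arrivalRate) m.phLaw) :=
    inferInstanceAs (IsProbabilityMeasure m.discardSupLaw)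
  obtain ⟨θ, hθ, C, hC⟩ := tail_supSurplusLaw_le m.discard_rate_pos
    m.phLaw_phaseType.zero_mem_interior_integrableExpSet
    (by have := m.ρd_lt_one; rw [ρd] at this; linarith) aemeasurable_of_isProbabilityMeasure
  have hlim := (hsub.tendsto_exp_div_tail hθ).const_mul C
  rw [mul_zero] at hlim
  refine squeeze_zero' (Eventually.of_forall fun u => ?_) ?_ hlim
  · exact div_nonneg (tail_nonneg _ _) (tail_nonneg _ _)
  · filter_upwards [eventually_ge_atTop 0] with u hu
    rw [← mul_div_assoc]
    exact div_le_div_of_nonneg_right (hC u hu) (tail_nonneg _ _)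

end MixtureModel

/-! ### The control variate estimator for rare events -/

section Estimator

variable {Ω : Type*} {R : ℕ} {X Y : Fin R → Ω → ℝ} {a d : Fin R → ℝ} {c y : ℝ} {ω : Ω}

lemma empMean_mem_Icc (hR : 0 < R) (ha : ∀ i, a i ∈ Set.Icc 0 1) (hX : ∀ i, X i ω = c * a i)
    (hc : 0 ≤ c) : empMean X ω ∈ Set.Icc 0 c := by
  have hR' : (0 : ℝ) < R := by exact_mod_cast hR
  have h1 : ∀ i, 0 ≤ X i ω := fun i => by rw [hX]; exact mul_nonneg hc (ha i).1
  have h2 : ∀ i, X i ω ≤ c := fun i => by rw [hX]; exact mul_le_of_le_one_right hc (ha i).2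
  refine ⟨div_nonneg (Finset.sum_nonneg fun i _ => h1 i) hR'.le, ?_⟩
  rw [empMean, div_le_iff₀ hR']
  refine (Finset.sum_le_sum fun i _ => h2 i).trans_eq ?_
  simp [mul_comm]

/-- Two controls that differ are `c` apart, so a nonzero denominator is at least `c ^ 2 / 2`, while
the numerator is at most `R * c ^ 2`. The bound does not depend on how rare the events are. -/
lemma abs_empCoeff_le (hR : 0 < R) (ha : ∀ i, a i = 0 ∨ a i = 1) (hd : ∀ i, d i = 0 ∨ d i = 1)
    (hX : ∀ i, X i ω = c * a i) (hY : ∀ i, Y i ω = c * d i) (hc : 0 < c) :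
    |empCoeff X Y ω| ≤ 2 * R := by
  have hR' : (0 : ℝ) < R := by exact_mod_cast hR
  have ha' : ∀ i, a i ∈ Set.Icc (0 : ℝ) 1 := fun i => by rcases ha i with h | h <;> simp [h]
  have hd' : ∀ i, d i ∈ Set.Icc (0 : ℝ) 1 := fun i => by rcases hd i with h | h <;> simp [h]
  have hmX := empMean_mem_Icc hR ha' hX hc.le
  have hmY := empMean_mem_Icc hR hd' hY hc.le
  rw [empCoeff, abs_neg, abs_div]
  set Q := ∑ i, (Y i ω - empMean Y ω) ^ 2 with hQ
  have hQ0 : 0 ≤ Q := Finset.sum_nonneg fun i _ => sq_nonneg _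
  by_cases hex : ∃ i j, d i ≠ d j
  · obtain ⟨i, j, hij⟩ := hex
    have hne : i ≠ j := fun h => hij (by rw [h])
    have hQ1 : c ^ 2 / 2 ≤ Q := by
      have h1 : (Y i ω - empMean Y ω) ^ 2 + (Y j ω - empMean Y ω) ^ 2 ≤ Q := by
        rw [hQ, ← Finset.sum_pair (f := fun k => (Y k ω - empMean Y ω) ^ 2) hne]
        exact Finset.sum_le_sum_of_subset_of_nonneg (Finset.subset_univ _)
          fun k _ _ => sq_nonneg _
      have h2 : (Y i ω - Y j ω) ^ 2 = c ^ 2 := by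
        rw [hY, hY]
        rcases hd i with h | h <;> rcases hd j with h' | h' <;> simp_all
      nlinarith [sq_nonneg (Y i ω - empMean Y ω + (Y j ω - empMean Y ω))]
    have hnum : |∑ i, (X i ω - empMean X ω) * (Y i ω - empMean Y ω)| ≤ R * c ^ 2 := by
      have hterm : ∀ k ∈ Finset.univ,
          |(X k ω - empMean X ω) * (Y k ω - empMean Y ω)| ≤ c ^ 2 := by
        intro k _
        have h1 : |X k ω - empMean X ω| ≤ c := by
          rw [hX, abs_le]
          have := mul_nonneg hc.le (ha' k).1
          have := mul_le_of_le_one_right hc.le (ha' k).2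
          constructor <;> linarith [hmX.1, hmX.2]
        have h2 : |Y k ω - empMean Y ω| ≤ c := by
          rw [hY, abs_le]
          have := mul_nonneg hc.le (hd' k).1
          have := mul_le_of_le_one_right hc.le (hd' k).2
          constructor <;> linarith [hmY.1, hmY.2]
        rw [abs_mul, sq]
        exact mul_le_mul h1 h2 (abs_nonneg _) hc.le
      refine (Finset.abs_sum_le_sum_abs _ _).trans ((Finset.sum_le_sum hterm).trans_eq ?_)
      simp
    have hQpos : 0 < Q := lt_of_lt_of_le (by positivity) hQ1
    rw [abs_of_pos hQpos, div_le_iff₀ hQpos]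
    calc _ ≤ R * c ^ 2 := hnum
      _ = 2 * R * (c ^ 2 / 2) := by ring
      _ ≤ _ := by gcongr
  -- All controls coincide, so the quotient is `0 / 0 = 0`.
  · push Not at hex
    have hY0 : ∀ i, Y i ω - empMean Y ω = 0 := by
      intro i
      have : ∀ j, Y j ω = c * d i := fun j => by rw [hY, hex j i]
      simp only [empMean, this]
      simp
      field_simp
      ring
    simp only [hQ, hY0]
    simp

lemma abs_cvEstimator_le (hR : 0 < R) (ha : ∀ i, a i = 0 ∨ a i = 1)
    (hd : ∀ i, d i = 0 ∨ d i = 1) (hX : ∀ i, X i ω = c * a i) (hY : ∀ i, Y i ω = c * d i)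
    (hc : 0 < c) (hy : |y| ≤ c) : |cvEstimator X Y y ω| ≤ c + 2 * R * (2 * c) := by
  have ha' : ∀ i, a i ∈ Set.Icc (0 : ℝ) 1 := fun i => by rcases ha i with h | h <;> simp [h]
  have hd' : ∀ i, d i ∈ Set.Icc (0 : ℝ) 1 := fun i => by rcases hd i with h | h <;> simp [h]
  have hmX := empMean_mem_Icc hR ha' hX hc.le
  have hmY := empMean_mem_Icc hR hd' hY hc.le
  refine (abs_add_le _ _).trans (add_le_add ?_ ?_)
  · rw [abs_of_nonneg hmX.1]; exact hmX.2
  · rw [abs_mul]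
    refine mul_le_mul (abs_empCoeff_le hR ha hd hX hY hc) ?_ (abs_nonneg _) (by positivity)
    rw [abs_le] at *
    constructor <;> linarith [hmY.1, hmY.2, hy.1, hy.2]

lemma cvEstimator_eq_empMean (h : ∀ i, Y i ω = 0) : cvEstimator X Y y ω = empMean X ω := by
  simp [cvEstimator, empCoeff, empMean, h]

/-- With `X = Y` not constant over the replications, the regression coefficient is exactly `-1` and
the empirical means cancel. `2 ≤ R` is what makes a single success non-constant. -/
lemma cvEstimator_eq_of_eq (hR : 2 ≤ R) (hc : c ≠ 0) {i₀ : Fin R}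
    (hX : ∀ i, X i ω = if i = i₀ then c else 0) (hY : ∀ i, Y i ω = X i ω) :
    cvEstimator X Y y ω = y := by
  have hR' : (2 : ℝ) ≤ R := by exact_mod_cast hR
  have hmean : empMean X ω = c / R := by simp [empMean, hX]
  have hmean' : empMean Y ω = empMean X ω := by simp [empMean, hY]
  have hQ : 0 < ∑ i, (X i ω - empMean X ω) ^ 2 := by
    refine Finset.sum_pos' (fun i _ => sq_nonneg _) ⟨i₀, Finset.mem_univ _, ?_⟩
    rw [hmean, hX, if_pos rfl]
    have h1 : c - c / R = c * (1 - 1 / R) := by ring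
    have h2 : (0 : ℝ) < 1 - 1 / R := by
      rw [sub_pos, div_lt_one (by linarith)]; linarith
    rw [h1]
    positivity
  have hcoeff : empCoeff X Y ω = -1 := by
    simp only [empCoeff, hmean', hY]
    rw [neg_inj, div_eq_one_iff_eq hQ.ne']
    exact Finset.sum_congr rfl fun i _ => (sq _).symm
  rw [cvEstimator, hcoeff, hmean']; ring

/-- Up to configurations with two or more successes, the control variate estimator sees only the
successes that the control misses. -/
lemma cvEstimator_pointwise (hR : 2 ≤ R) (ha : ∀ i, a i = 0 ∨ a i = 1)
    (hd : ∀ i, d i = 0 ∨ d i = 1) (hda : ∀ i, d i ≤ a i)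
    (hX : ∀ i, X i ω = c * a i) (hY : ∀ i, Y i ω = c * d i) (hc : 0 < c) (hy : |y| ≤ c) :
    |cvEstimator X Y y ω ^ 2 - (c / R) ^ 2 * ∑ i, (a i - d i)| ≤
        y ^ 2 * ∑ i, a i +
          (c + 2 * R * (2 * c)) ^ 2 * ∑ z ∈ Finset.univ.offDiag, a z.1 * a z.2 ∧
      |cvEstimator X Y y ω| ≤ (c + 2 * R * (2 * c)) * ∑ i, a i := by
  have hR' : (2 : ℝ) ≤ R := by exact_mod_cast hR
  set K := c + 2 * R * (2 * c) with hK
  have hK0 : 0 < K := by positivity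
  have hcK : c ≤ K := by rw [hK]; nlinarith
  have hZ := abs_cvEstimator_le (y := y) (by omega) ha hd hX hY hc hy
  have ha0 : ∀ i, 0 ≤ a i := fun i => by rcases ha i with h | h <;> simp [h]
  have hoff : 0 ≤ ∑ z ∈ Finset.univ.offDiag, a z.1 * a z.2 :=
    Finset.sum_nonneg fun z _ => mul_nonneg (ha0 _) (ha0 _)
  by_cases h0 : ∀ i, a i = 0
  · have hd0 : ∀ i, d i = 0 := fun i => by
      rcases hd i with h | h
      · exact h
      · have := hda i; rw [h0, h] at this; linarith
    have hZ0 : cvEstimator X Y y ω = 0 := by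
      rw [cvEstimator_eq_empMean (by simp [hY, hd0])]
      simp [empMean, hX, h0]
    simp [hZ0, h0, hd0]
  push Not at h0
  obtain ⟨i₀, hi₀⟩ := h0
  replace hi₀ : a i₀ = 1 := (ha i₀).resolve_left hi₀
  have hsum1 : 1 ≤ ∑ i, a i := by
    rw [← hi₀]; exact Finset.single_le_sum (fun i _ => ha0 i) (Finset.mem_univ _)
  refine ⟨?_, hZ.trans (le_mul_of_one_le_right hK0.le hsum1)⟩
  by_cases h1 : ∀ i, i ≠ i₀ → a i = 0
  · have haeq : ∀ i, a i = if i = i₀ then 1 else 0 := fun i => by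
      split_ifs with h
      · rw [h, hi₀]
      · exact h1 i h
    have hd0 : ∀ i, i ≠ i₀ → d i = 0 := fun i hi => by
      rcases hd i with h | h
      · exact h
      · have := hda i; rw [h1 i hi, h] at this; linarith
    have hX' : ∀ i, X i ω = if i = i₀ then c else 0 := fun i => by
      rw [hX, haeq]; split_ifs <;> simp
    have hsuma : ∑ i, a i = 1 := by simp [haeq]
    have hsumd : ∑ i, d i = d i₀ := Fintype.sum_eq_single i₀ hd0
    rw [Finset.sum_sub_distrib, hsuma, hsumd]
    rcases hd i₀ with hd₀ | hd₀
    -- A missed single success: the estimator is `c / R`, matching the main term exactly.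
    · have hY0 : ∀ i, Y i ω = 0 := fun i => by
        by_cases h : i = i₀
        · rw [hY, h, hd₀, mul_zero]
        · rw [hY, hd0 i h, mul_zero]
      have hZ1 : cvEstimator X Y y ω = c / R := by
        rw [cvEstimator_eq_empMean hY0]; simp [empMean, hX']
      rw [hZ1, hd₀]
      simp only [sub_zero, mul_one, sub_self, abs_zero]
      positivity
    -- A caught single success: the main term vanishes and `y ^ 2` is left as error.
    · have hYX : ∀ i, Y i ω = X i ω := fun i => by
        by_cases h : i = i₀
        · rw [hY, hX, h, hd₀, hi₀]
        · rw [hY, hX, hd0 i h, h1 i h]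
      rw [cvEstimator_eq_of_eq hR hc.ne' hX' hYX, hd₀]
      simp only [sub_self, mul_zero, sub_zero, mul_one, abs_sq]
      have := mul_nonneg (sq_nonneg K) hoff
      linarith
  -- Two successes: crude bounds suffice, because the off-diagonal sum is at least `1`.
  · push Not at h1
    obtain ⟨j, hj, hj1⟩ := h1
    replace hj1 : a j = 1 := (ha j).resolve_left hj1
    have hoff1 : 1 ≤ ∑ z ∈ Finset.univ.offDiag, a z.1 * a z.2 := by
      have : a (j, i₀).1 * a (j, i₀).2 ≤ ∑ z ∈ Finset.univ.offDiag, a z.1 * a z.2 :=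
        Finset.single_le_sum (f := fun z : Fin R × Fin R => a z.1 * a z.2)
          (fun z _ => mul_nonneg (ha0 _) (ha0 _)) (by simpa using hj)
      simpa [hj1, hi₀] using this
    have hZ2 : cvEstimator X Y y ω ^ 2 ≤ K ^ 2 := by
      rw [← sq_abs]; exact pow_le_pow_left₀ (abs_nonneg _) hZ 2
    have hT0 : 0 ≤ ∑ i, (a i - d i) := Finset.sum_nonneg fun i _ => sub_nonneg.2 (hda i)
    have hTR : ∑ i, (a i - d i) ≤ R := by
      have : ∀ i ∈ Finset.univ, a i - d i ≤ 1 := fun i _ => by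
        rcases ha i with h | h <;> rcases hd i with h' | h' <;> simp [h, h']
      refine (Finset.sum_le_sum this).trans_eq (by simp)
    have hT : (c / R) ^ 2 * ∑ i, (a i - d i) ≤ K ^ 2 := by
      calc (c / R) ^ 2 * ∑ i, (a i - d i) ≤ (c / R) ^ 2 * R := by gcongr
        _ = c ^ 2 * (1 / R) := by field_simp
        _ ≤ c ^ 2 * 1 := by gcongr; rw [div_le_one (by linarith)]; linarith
        _ ≤ K ^ 2 := by rw [mul_one]; gcongr
    have hT' : 0 ≤ (c / R) ^ 2 * ∑ i, (a i - d i) := by positivity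
    have hfin : |cvEstimator X Y y ω ^ 2 - (c / R) ^ 2 * ∑ i, (a i - d i)| ≤ K ^ 2 := by
      rw [abs_le]
      constructor <;> linarith [sq_nonneg (cvEstimator X Y y ω)]
    refine hfin.trans ((le_mul_of_one_le_right (sq_nonneg K) hoff1).trans ?_)
    have : 0 ≤ y ^ 2 * ∑ i, a i := by positivity
    linarith

variable [MeasurableSpace Ω] {P : Measure Ω} [IsProbabilityMeasure P]

lemma measurable_cvEstimator (hX : ∀ i, Measurable (X i)) (hY : ∀ i, Measurable (Y i)) (y : ℝ) :
    Measurable (cvEstimator X Y y) := by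
  have hmX : Measurable (empMean X) := by
    unfold empMean; fun_prop
  have hmY : Measurable (empMean Y) := by
    unfold empMean; fun_prop
  unfold cvEstimator empCoeff
  fun_prop

/-- The variance of the control variate estimator for rare events `A i` with controls
`D i ⊆ A i`. -/
lemma abs_variance_cvEstimator_sub_le (hR : 2 ≤ R) (hc : 0 < c) (hy : |y| ≤ c)
    {A D : Fin R → Set Ω} (hA : ∀ i, MeasurableSet (A i)) (hD : ∀ i, MeasurableSet (D i))
    (hDA : ∀ i, D i ⊆ A i)
    (hind : ∀ i j, i ≠ j → P.real (A i ∩ A j) = P.real (A i) * P.real (A j)) :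
    |variance (cvEstimator (fun i ω => c * (A i).indicator 1 ω)
        (fun i ω => c * (D i).indicator 1 ω) y) P -
        (c / R) ^ 2 * ∑ i, (P.real (A i) - P.real (D i))| ≤
      (∑ i, P.real (A i)) *
        (y ^ 2 + 2 * (c + 2 * R * (2 * c)) ^ 2 * ∑ i, P.real (A i)) := by
  set K := c + 2 * R * (2 * c) with hK
  set Z := cvEstimator (fun i ω => c * (A i).indicator 1 ω)
    (fun i ω => c * (D i).indicator 1 ω) y with hZ
  have h01 : ∀ (S : Set Ω) (ω : Ω), S.indicator (1 : Ω → ℝ) ω = 0 ∨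
      S.indicator (1 : Ω → ℝ) ω = 1 := by
    intro S ω
    by_cases h : ω ∈ S <;> simp [h]
  have hpt := fun ω => cvEstimator_pointwise (ω := ω) (X := fun i ω => c * (A i).indicator 1 ω)
    (Y := fun i ω => c * (D i).indicator 1 ω) hR (fun i => h01 (A i) ω) (fun i => h01 (D i) ω)
    (fun i => Set.indicator_le_indicator_of_subset (hDA i) (fun _ => zero_le_one) ω)
    (fun i => rfl) (fun i => rfl) hc hy
  have hbd : ∀ ω, |Z ω| ≤ K := fun ω => abs_cvEstimator_le (by omega) (fun i => h01 (A i) ω)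
    (fun i => h01 (D i) ω) (fun i => rfl) (fun i => rfl) hc hy
  have hiA : ∀ {S : Set Ω}, MeasurableSet S → Integrable (S.indicator (1 : Ω → ℝ)) P :=
    fun hS => (integrable_const 1).indicator hS
  have hmeas : Measurable Z := measurable_cvEstimator
    (fun i => (measurable_one.indicator (hA i)).const_mul c)
    (fun i => (measurable_one.indicator (hD i)).const_mul c) y
  have hLp : MemLp Z 2 P := MemLp.of_bound hmeas.aestronglyMeasurable K
    (Eventually.of_forall hbd)
  have hZ1 : Integrable Z P := hLp.integrable one_le_two
  have hZ2 : Integrable (fun ω => Z ω ^ 2) P := hLp.integrable_sq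
  have hEA : ∀ i, ∫ ω, (A i).indicator (1 : Ω → ℝ) ω ∂P = P.real (A i) :=
    fun i => integral_indicator_one (hA i)
  have hED : ∀ i, ∫ ω, (D i).indicator (1 : Ω → ℝ) ω ∂P = P.real (D i) :=
    fun i => integral_indicator_one (hD i)
  have hsumA : ∫ ω, ∑ i, (A i).indicator (1 : Ω → ℝ) ω ∂P = ∑ i, P.real (A i) := by
    rw [integral_finsetSum _ fun i _ => hiA (hA i)]
    exact Finset.sum_congr rfl fun i _ => hEA i
  have hIsumA : Integrable (fun ω => ∑ i, (A i).indicator (1 : Ω → ℝ) ω) P :=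
    integrable_finsetSum _ fun i _ => hiA (hA i)
  have hIdiff : Integrable (fun ω => ∑ i, ((A i).indicator (1 : Ω → ℝ) ω -
      (D i).indicator (1 : Ω → ℝ) ω)) P :=
    integrable_finsetSum _ fun i _ => (hiA (hA i)).sub (hiA (hD i))
  have hsumdiff : ∫ ω, ∑ i, ((A i).indicator (1 : Ω → ℝ) ω - (D i).indicator (1 : Ω → ℝ) ω) ∂P =
      ∑ i, (P.real (A i) - P.real (D i)) := by
    have hI : ∀ i, Integrable (fun ω => (A i).indicator (1 : Ω → ℝ) ω -
        (D i).indicator (1 : Ω → ℝ) ω) P := fun i => (hiA (hA i)).sub (hiA (hD i))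
    rw [integral_finsetSum _ fun i _ => hI i]
    refine Finset.sum_congr rfl fun i _ => ?_
    rw [integral_sub (hiA (hA i)) (hiA (hD i)), hEA, hED]
  have hprod : ∀ i j, (fun ω => (A i).indicator (1 : Ω → ℝ) ω * (A j).indicator (1 : Ω → ℝ) ω) =
      (A i ∩ A j).indicator 1 := by
    intro i j; ext ω
    by_cases h : ω ∈ A i <;> by_cases h' : ω ∈ A j <;> simp [h, h']
  have hIprod : ∀ i j, Integrable
      (fun ω => (A i).indicator (1 : Ω → ℝ) ω * (A j).indicator (1 : Ω → ℝ) ω) P := by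
    intro i j; rw [hprod]; exact hiA ((hA i).inter (hA j))
  have hIoff : Integrable (fun ω => ∑ z ∈ (Finset.univ : Finset (Fin R)).offDiag,
      (A z.1).indicator (1 : Ω → ℝ) ω * (A z.2).indicator (1 : Ω → ℝ) ω) P :=
    integrable_finsetSum _ fun z _ => hIprod _ _
  -- Pairwise independence factors each term; adding the diagonal completes the square.
  have hsumoff : ∫ ω, ∑ z ∈ (Finset.univ : Finset (Fin R)).offDiag,
      (A z.1).indicator (1 : Ω → ℝ) ω * (A z.2).indicator (1 : Ω → ℝ) ω ∂P ≤
      (∑ i, P.real (A i)) ^ 2 := by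
    rw [integral_finsetSum _ fun z _ => hIprod _ _, sq, Finset.sum_mul_sum,
      ← Finset.sum_product']
    calc _ = ∑ z ∈ (Finset.univ : Finset (Fin R)).offDiag, P.real (A z.1) * P.real (A z.2) := by
          refine Finset.sum_congr rfl fun z hz => ?_
          rw [hprod, integral_indicator_one ((hA _).inter (hA _)),
            hind _ _ (by simpa using hz)]
      _ ≤ _ := Finset.sum_le_sum_of_subset_of_nonneg (fun z _ => by simp)
        fun z _ _ => mul_nonneg measureReal_nonneg measureReal_nonneg
  have hS0 : 0 ≤ ∑ i, P.real (A i) := Finset.sum_nonneg fun i _ => measureReal_nonneg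
  have hmean : |∫ ω, Z ω ∂P| ≤ K * ∑ i, P.real (A i) := by
    refine abs_integral_le_integral_abs.trans ?_
    rw [← hsumA, ← integral_const_mul]
    exact integral_mono hZ1.abs (hIsumA.const_mul K) fun ω => (hpt ω).2
  have hsec : |∫ ω, Z ω ^ 2 ∂P - (c / R) ^ 2 * ∑ i, (P.real (A i) - P.real (D i))| ≤
      y ^ 2 * ∑ i, P.real (A i) + K ^ 2 * (∑ i, P.real (A i)) ^ 2 := by
    rw [← hsumdiff, ← integral_const_mul, ← integral_sub hZ2 (hIdiff.const_mul _)]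
    refine abs_integral_le_integral_abs.trans ?_
    refine (integral_mono (hZ2.sub (hIdiff.const_mul _)).abs
      ((hIsumA.const_mul _).add (hIoff.const_mul _)) fun ω => (hpt ω).1).trans ?_
    rw [integral_add' (hIsumA.const_mul _) (hIoff.const_mul _), integral_const_mul,
      integral_const_mul, hsumA]
    gcongr
  rw [variance_eq_sub hLp]
  have hm2 : (∫ ω, Z ω ∂P) ^ 2 ≤ K ^ 2 * (∑ i, P.real (A i)) ^ 2 := by
    rw [← mul_pow, ← sq_abs]
    exact pow_le_pow_left₀ (abs_nonneg _) hmean 2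
  have hm3 := sq_nonneg (∫ ω, Z ω ∂P)
  rw [abs_le] at hsec ⊢
  simp only [Pi.pow_apply]
  constructor <;> nlinarith [hsec.1, hsec.2]

/-- Rare-event asymptotics of the variance of the control variate estimator. -/
lemma tendsto_variance_cvEstimator (hR : 2 ≤ R) (hc : 0 < c) {A D : ℝ → Fin R → Set Ω}
    {y f : ℝ → ℝ} {α β : ℝ} (hA : ∀ u i, MeasurableSet (A u i))
    (hD : ∀ u i, MeasurableSet (D u i)) (hDA : ∀ᶠ u in atTop, ∀ i, D u i ⊆ A u i)
    (hind : ∀ u i j, i ≠ j → P.real (A u i ∩ A u j) = P.real (A u i) * P.real (A u j))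
    (hy : Tendsto y atTop (𝓝 0)) (hf : ∀ u, 0 < f u) (hf0 : Tendsto f atTop (𝓝 0))
    (hα : ∀ i, Tendsto (fun u => P.real (A u i) / f u) atTop (𝓝 α))
    (hβ : ∀ i, Tendsto (fun u => P.real (D u i) / f u) atTop (𝓝 β)) :
    Tendsto (fun u => variance (cvEstimator (fun i ω => c * (A u i).indicator 1 ω)
        (fun i ω => c * (D u i).indicator 1 ω) (y u)) P / f u) atTop
      (𝓝 (c ^ 2 / R * (α - β))) := by
  have hR' : (2 : ℝ) ≤ R := by exact_mod_cast hR
  set S : ℝ → ℝ := fun u => ∑ i, P.real (A u i) with hS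
  have hSf : Tendsto (fun u => S u / f u) atTop (𝓝 (R * α)) := by
    have := tendsto_finsetSum Finset.univ fun i _ => hα i
    simp only [Finset.sum_const, Finset.card_univ, Fintype.card_fin, nsmul_eq_mul] at this
    exact this.congr fun u => by rw [hS, Finset.sum_div]
  have hS0 : Tendsto S atTop (𝓝 0) := by
    have := hSf.mul hf0
    rw [mul_zero] at this
    exact this.congr fun u => div_mul_cancel₀ _ (hf u).ne'
  have hmain : Tendsto (fun u => (c / R) ^ 2 * ∑ i, (P.real (A u i) - P.real (D u i)) / f u) atTop
      (𝓝 (c ^ 2 / R * (α - β))) := by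
    have := (tendsto_finsetSum Finset.univ fun i _ => (hα i).sub (hβ i)).const_mul ((c / R) ^ 2)
    simp only [Finset.sum_const, Finset.card_univ, Fintype.card_fin, nsmul_eq_mul] at this
    rw [show c ^ 2 / R * (α - β) = (c / R) ^ 2 * (R * (α - β)) by field_simp]
    exact this.congr fun u => by simp only [sub_div]
  have herr : Tendsto (fun u => S u / f u *
      (y u ^ 2 + 2 * (c + 2 * R * (2 * c)) ^ 2 * S u)) atTop (𝓝 0) := by
    have := hSf.mul ((hy.pow 2).add (hS0.const_mul (2 * (c + 2 * R * (2 * c)) ^ 2)))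
    simpa using this
  have hdiff := squeeze_zero_norm' (a := fun u => S u / f u *
      (y u ^ 2 + 2 * (c + 2 * R * (2 * c)) ^ 2 * S u)) (f := fun u =>
    variance (cvEstimator (fun i ω => c * (A u i).indicator 1 ω)
        (fun i ω => c * (D u i).indicator 1 ω) (y u)) P / f u -
      (c / R) ^ 2 * ∑ i, (P.real (A u i) - P.real (D u i)) / f u) ?_ herr
  · simpa using hdiff.add hmain
  · have hyc : ∀ᶠ u in atTop, |y u| ≤ c := by
      have := hy.abs
      rw [abs_zero] at this
      exact this.eventually_le_const hc
    filter_upwards [hyc, hDA] with u h1 h2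
    rw [← Finset.sum_div, ← mul_div_assoc, ← sub_div, norm_div, Real.norm_of_nonneg (hf u).le,
      div_mul_eq_mul_div]
    refine div_le_div_of_nonneg_right ?_ (hf u).le
    exact abs_variance_cvEstimator_sub_le hR hc h1 (hA u) (hD u) h2 (hind u)

end Estimator

/-! ### Independence of blocks of variables -/

section Blocks

variable {Ω ι : Type*} {F : ι → Ω → ℝ} {S T : Set ι}

/-- The σ-algebra generated by a subfamily of a family of real random variables. -/
def blockSigma (F : ι → Ω → ℝ) (S : Set ι) : MeasurableSpace Ω :=
  ⨆ s ∈ S, (inferInstance : MeasurableSpace ℝ).comap (F s)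

lemma measurable_blockSigma {s : ι} (hs : s ∈ S) : Measurable[blockSigma F S] (F s) :=
  Measurable.mono (comap_measurable (F s)) (le_biSup (fun s => MeasurableSpace.comap (F s) _) hs)
    le_rfl

variable [MeasurableSpace Ω] {P : Measure Ω}

lemma indep_blockSigma (hF : ∀ s, Measurable (F s)) (h : iIndepFun F P) (hST : Disjoint S T) :
    Indep (blockSigma F S) (blockSigma F T) P :=
  indep_iSup_of_disjoint (fun s => (hF s).comap_le) h.iIndep hST

lemma indepFun_of_measurable_blockSigma (hF : ∀ s, Measurable (F s)) (h : iIndepFun F P)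
    (hST : Disjoint S T) {f g : Ω → ℝ} (hf : Measurable[blockSigma F S] f)
    (hg : Measurable[blockSigma F T] g) : IndepFun f g P := by
  rw [IndepFun_iff_Indep]
  exact indep_of_indep_of_le (indep_blockSigma hF h hST) hf.comap_le hg.comap_le

end Blocks

/-! ### Ladder sums and exceedance events -/

variable {Ω : Type*} {R : ℕ}

/-- The sum `M 0 + ∑_{j ≤ k} (M j + B j)`. -/
def ladderSum (M B : ℕ → Ω → ℝ) (k : ℕ) (ω : Ω) : ℝ :=
  M 0 ω + ∑ j ∈ Finset.range k, (M (j + 1) ω + B (j + 1) ω)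

lemma ladderSum_succ (M B : ℕ → Ω → ℝ) (k : ℕ) (ω : Ω) :
    ladderSum M B (k + 1) ω = ladderSum M B k ω + (M (k + 1) ω + B (k + 1) ω) := by
  rw [ladderSum, Finset.sum_range_succ, ladderSum]; ring

lemma V_eq_ladderSum (M B : ℕ → Ω → ℝ) (N : Ω → ℕ) (ω : Ω) :
    V M B N ω = ladderSum M B (N ω + 2) ω := by
  have key : ∀ k, M 0 ω + M 1 ω + B 1 ω + ∑ j ∈ Finset.Icc 2 (k + 2), (M j ω + B j ω) =
      ladderSum M B (k + 2) ω := by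
    intro k
    induction k with
    | zero => simp [ladderSum, Finset.sum_range_succ]; ring
    | succ k ih =>
      rw [Finset.sum_Icc_succ_top (by omega), ← add_assoc, ih, ladderSum_succ M B (k + 2)]
  exact key (N ω)

lemma lt_truncMax_iff {n : ℕ} {B : ℕ → Ω → ℝ} {N : Ω → ℕ} {ω : Ω} {u : ℝ} (hu : 0 ≤ u) :
    u < truncMax n B N ω ↔ N ω + 2 ≤ n ∧ ∃ k ∈ Finset.Icc 1 (N ω + 2), u < B k ω := by
  unfold truncMax
  split_ifs with h
  · rw [Finset.lt_sup'_iff]; simp [h]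
  · simp [h, hu]

lemma lt_V_of_lt_truncMax {n : ℕ} {M B : ℕ → Ω → ℝ} {N : Ω → ℕ} {ω : Ω} {u : ℝ} (hu : 0 ≤ u)
    (hM : ∀ k, 0 ≤ M k ω) (hB : ∀ k, 0 ≤ B k ω) (h : u < truncMax n B N ω) :
    u < V M B N ω := by
  obtain ⟨-, k, hk, hlt⟩ := (lt_truncMax_iff hu).1 h
  rw [Finset.mem_Icc] at hk
  rw [V_eq_ladderSum, ladderSum]
  have h1 : M (k - 1 + 1) ω + B (k - 1 + 1) ω ≤
      ∑ j ∈ Finset.range (N ω + 2), (M (j + 1) ω + B (j + 1) ω) :=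
    Finset.single_le_sum (f := fun j => M (j + 1) ω + B (j + 1) ω)
      (fun j _ => add_nonneg (hM _) (hB _)) (Finset.mem_range.2 (by omega))
  rw [Nat.sub_add_cancel hk.1] at h1
  linarith [hM 0, hM k]

/-- The replication to which a random variable of the simulation belongs. -/
def SimIndex.owner : SimIndex R → Fin R
  | .sup i _ => i
  | .excess i _ => i
  | .geom i => i

/-- The labels of the variables of the `i`-th replication which enter its first `k` ladder
steps. -/
def ladderIndices (i : Fin R) (k : ℕ) : Set (SimIndex R) :=
  {s | ∃ j ≤ k, s = .sup i j ∨ s = .excess i j}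

section Measurability

variable {M B : Fin R → ℕ → Ω → ℝ} {N : Fin R → Ω → ℕ} {i : Fin R}

lemma measurable_ladderSum_blockSigma {S : Set (SimIndex R)} {k : ℕ}
    (hS : ladderIndices i k ⊆ S) :
    Measurable[blockSigma (simFamily M B N) S] (ladderSum (M i) (B i) k) := by
  have hM : ∀ j ≤ k, Measurable[blockSigma (simFamily M B N) S] (M i j) := fun j hj =>
    measurable_blockSigma (F := simFamily M B N) (s := SimIndex.sup i j)
      (hS ⟨j, hj, Or.inl rfl⟩)
  have hB : ∀ j ≤ k, Measurable[blockSigma (simFamily M B N) S] (B i j) := fun j hj =>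
    measurable_blockSigma (F := simFamily M B N) (s := SimIndex.excess i j)
      (hS ⟨j, hj, Or.inr rfl⟩)
  let _ : MeasurableSpace Ω := blockSigma (simFamily M B N) S
  refine Measurable.add (hM 0 (Nat.zero_le _)) (Finset.measurable_fun_sum _ fun j hj => ?_)
  have hj' := Finset.mem_range.1 hj
  exact Measurable.add (hM _ (by omega)) (hB _ (by omega))

lemma measurableSet_geom_blockSigma {S : Set (SimIndex R)} (hS : SimIndex.geom i ∈ S) (k : ℕ) :
    MeasurableSet[blockSigma (simFamily M B N) S] {ω | N i ω = k} := by
  have h1 := measurable_blockSigma (F := simFamily M B N) hS (measurableSet_singleton (k : ℝ))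
  convert h1 using 1
  ext ω
  simp [simFamily]

/-- The exceedance event of the target variable, split by the value of the geometric variable. -/
lemma setOf_lt_V_eq (M B : ℕ → Ω → ℝ) (N : Ω → ℕ) (u : ℝ) :
    {ω | u < V M B N ω} = ⋃ k, {ω | N ω = k} ∩ {ω | u < ladderSum M B (k + 2) ω} := by
  ext ω
  simp [V_eq_ladderSum]

lemma measurableSet_lt_V_blockSigma (u : ℝ) :
    MeasurableSet[blockSigma (simFamily M B N) {s | s.owner = i}]
      {ω | u < V (M i) (B i) (N i) ω} := by
  rw [setOf_lt_V_eq]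
  have h1 : ∀ k, MeasurableSet[blockSigma (simFamily M B N) {s | s.owner = i}]
      {ω | N i ω = k} := fun k =>
    measurableSet_geom_blockSigma (show (SimIndex.geom i).owner = i from rfl) k
  have h2 : ∀ k, Measurable[blockSigma (simFamily M B N) {s | s.owner = i}]
      (ladderSum (M i) (B i) (k + 2)) := fun k => by
    refine measurable_ladderSum_blockSigma ?_
    rintro s ⟨j, -, rfl | rfl⟩ <;> rfl
  generalize blockSigma (simFamily M B N) {s | s.owner = i} = mΩ at h1 h2 ⊢
  have h3 : ∀ k, MeasurableSet[mΩ] {ω | u < ladderSum (M i) (B i) (k + 2) ω} := fun k =>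
    h2 k (measurableSet_Ioi (a := u))
  exact MeasurableSet.iUnion fun k => MeasurableSet.inter (h1 k) (h3 k)

/-- The exceedance event of the control variate, split by the value of the geometric variable. -/
lemma setOf_lt_truncMax_eq (n : ℕ) (B : ℕ → Ω → ℝ) (N : Ω → ℕ) {u : ℝ} (hu : 0 ≤ u) :
    {ω | u < truncMax n B N ω} = ⋃ k ∈ Finset.range (n - 1),
      {ω | N ω = k} ∩ (⋂ j ∈ Finset.Icc 1 (k + 2), {ω | B j ω ≤ u})ᶜ := by
  ext ω
  simp only [Set.mem_ofPred_eq, lt_truncMax_iff hu, Set.mem_iUnion, Set.mem_inter_iff,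
    Set.mem_compl_iff, Set.mem_iInter, Finset.mem_range, exists_prop]
  push Not
  constructor
  · rintro ⟨h1, h2⟩
    exact ⟨N ω, by omega, rfl, h2⟩
  · rintro ⟨k, h1, rfl, h2⟩
    exact ⟨by omega, h2⟩

lemma measurable_truncMax [MeasurableSpace Ω] {n : ℕ} {B : ℕ → Ω → ℝ} {N : Ω → ℕ}
    (hB : ∀ k, Measurable (B k)) (hN : Measurable N) : Measurable (truncMax n B N) := by
  have h1 : Measurable fun z : ℕ × Ω => if z.1 + 2 ≤ n then
      (Finset.Icc 1 (z.1 + 2)).sup' (Finset.nonempty_Icc.2 (by omega)) fun k => B k z.2 else 0 := by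
    refine measurable_from_prod_countable_right fun k => ?_
    dsimp only
    split_ifs with h
    · have := Finset.measurable_sup' (s := Finset.Icc 1 (k + 2)) (Finset.nonempty_Icc.2 (by omega))
        (fun j _ => hB j)
      convert this using 1
      ext ω
      simp
    · exact measurable_const
  exact h1.comp (hN.prodMk measurable_id)

end Measurability

lemma cvEstimator_congr {X Y X' Y' : Fin R → Ω → ℝ} {ω : Ω} (y : ℝ)
    (hX : ∀ i, X i ω = X' i ω) (hY : ∀ i, Y i ω = Y' i ω) :
    cvEstimator X Y y ω = cvEstimator X' Y' y ω := by
  simp [cvEstimator, empCoeff, empMean, hX, hY]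

/-! ### Laws and probabilities in a simulation -/

section Simulation

variable {m : MixtureModel} {M B : Fin R → ℕ → Ω → ℝ} {N : Fin R → Ω → ℕ}

lemma target_congr {M' B' : Fin R → ℕ → Ω → ℝ} {ω : Ω} (u : ℝ)
    (h : ∀ i k, M i k ω = M' i k ω ∧ B i k ω = B' i k ω) (i : Fin R) :
    target m M B N u i ω = target m M' B' N u i ω := by
  refine congrArg (m.p ^ 2 * ·) (if_congr ?_ rfl rfl)
  simp only [V, h, Set.mem_ofPred_eq]

lemma control_congr {B' : Fin R → ℕ → Ω → ℝ} {ω : Ω} (n : ℕ) (u : ℝ)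
    (h : ∀ i k, B i k ω = B' i k ω) (i : Fin R) :
    control m n B N u i ω = control m n B' N u i ω := by
  refine congrArg (m.p ^ 2 * ·) (if_congr ?_ rfl rfl)
  simp only [truncMax, h, Set.mem_ofPred_eq]


variable [MeasurableSpace Ω] {P : Measure Ω}

/-- A simulation can be replaced by one with measurable, nonnegative variables. -/
lemma IsSimulation.exists_modification (h : IsSimulation m P M B N)
    (hM : m.discardSupLaw (Set.Iio 0) = 0) (hB : m.htExcessLaw (Set.Iio 0) = 0) :
    ∃ M' B' : Fin R → ℕ → Ω → ℝ, IsSimulation m P M' B' N ∧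
      (∀ i k, Measurable (M' i k)) ∧ (∀ i k, Measurable (B' i k)) ∧
      (∀ i k ω, 0 ≤ M' i k ω) ∧ (∀ i k ω, 0 ≤ B' i k ω) ∧
      ∀ᵐ ω ∂P, ∀ i k, M i k ω = M' i k ω ∧ B i k ω = B' i k ω := by
  have key : ∀ {X : Ω → ℝ} {μ : Measure ℝ} (hX : HasLaw X μ P), μ (Set.Iio 0) = 0 →
      X =ᵐ[P] fun ω => |hX.aemeasurable.mk X ω| := by
    intro X μ hX hμ
    have h0 : ∀ᵐ ω ∂P, 0 ≤ X ω := 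
      (hX.ae_iff (p := fun x => 0 ≤ x) (by fun_prop)).2 (ae_nonneg_of_Iio_zero hμ)
    filter_upwards [hX.aemeasurable.ae_eq_mk, h0] with ω h1 h2
    rw [← h1, abs_of_nonneg h2]
  have eM := fun i k => key (h.law_sup i k) hM
  have eB := fun i k => key (h.law_excess i k) hB
  refine ⟨fun i k ω => |(h.law_sup i k).aemeasurable.mk _ ω|,
    fun i k ω => |(h.law_excess i k).aemeasurable.mk _ ω|,
    ⟨fun i k => (h.law_sup i k).congr (eM i k).symm,
      fun i k => (h.law_excess i k).congr (eB i k).symm, h.measurable_geom, h.law_geom, ?_⟩,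
    fun i k => (h.law_sup i k).aemeasurable.measurable_mk.abs,
    fun i k => (h.law_excess i k).aemeasurable.measurable_mk.abs,
    fun i k ω => abs_nonneg _, fun i k ω => abs_nonneg _, ?_⟩
  · refine h.indep.congr fun s => ?_
    cases s with
    | sup i k => exact eM i k
    | excess i k => exact eB i k
    | geom i => rfl
  · simp only [ae_all_iff]
    intro i k
    filter_upwards [eM i k, eB i k] with ω h1 h2 using ⟨h1, h2⟩

lemma measurable_simFamily (hM : ∀ i k, Measurable (M i k)) (hB : ∀ i k, Measurable (B i k))
    (hN : ∀ i, Measurable (N i)) (s : SimIndex R) : Measurable (simFamily M B N s) := by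
  cases s with
  | sup i k => exact hM i k
  | excess i k => exact hB i k
  | geom i => exact measurable_from_nat.comp (hN i)

/-- Step `k + 1` uses labels outside `ladderIndices i k`, hence is independent of the sum so far,
and each step contributes one more convolution factor. -/
lemma IsSimulation.hasLaw_ladderSum (h : IsSimulation m P M B N)
    (hM : ∀ i k, Measurable (M i k)) (hB : ∀ i k, Measurable (B i k))
    [IsProbabilityMeasure m.discardSupLaw] [IsProbabilityMeasure m.htExcessLaw] (i : Fin R)
    (k : ℕ) : HasLaw (ladderSum (M i) (B i) k)
      (m.discardSupLaw.conv (convPow (m.discardSupLaw.conv m.htExcessLaw) k)) P := by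
  have hF := measurable_simFamily hM hB h.measurable_geom
  induction k with
  | zero =>
    have : ladderSum (M i) (B i) 0 = M i 0 := by ext ω; simp [ladderSum]
    simpa [this, convPow] using h.law_sup i 0
  | succ k ih =>
    have hstep : IndepFun (M i (k + 1)) (B i (k + 1)) P :=
      h.indep.indepFun (i := SimIndex.sup i (k + 1)) (j := SimIndex.excess i (k + 1)) (by simp)
    have hlaw := hstep.hasLaw_fun_add (h.law_sup i (k + 1)) (h.law_excess i (k + 1))
    set T : Set (SimIndex R) := {SimIndex.sup i (k + 1), SimIndex.excess i (k + 1)} with hT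
    have hdisj : Disjoint (ladderIndices i k) T := by
      rw [Set.disjoint_left]
      rintro s ⟨j, hj, rfl | rfl⟩ hs <;> simp [hT] at hs <;> omega
    have h1 : Measurable[blockSigma (simFamily M B N) T] (M i (k + 1)) :=
      measurable_blockSigma (F := simFamily M B N) (s := SimIndex.sup i (k + 1)) (by simp [hT])
    have h2 : Measurable[blockSigma (simFamily M B N) T] (B i (k + 1)) :=
      measurable_blockSigma (F := simFamily M B N) (s := SimIndex.excess i (k + 1)) (by simp [hT])
    have h3 : Measurable[blockSigma (simFamily M B N) T]
        (fun ω => M i (k + 1) ω + B i (k + 1) ω) := by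
      clear hF h ih hstep hlaw
      let _ : MeasurableSpace Ω := blockSigma (simFamily M B N) T
      exact Measurable.add h1 h2
    have hind := indepFun_of_measurable_blockSigma hF h.indep hdisj
      (measurable_ladderSum_blockSigma subset_rfl) h3
    have hres := hind.hasLaw_fun_add ih hlaw
    rw [Measure.conv_assoc] at hres
    rw [convPow]
    exact hres.congr (Eventually.of_forall fun ω => ladderSum_succ (M i) (B i) k ω)

lemma IsSimulation.measureReal_geom_inter (h : IsSimulation m P M B N)
    (hM : ∀ i k, Measurable (M i k)) (hB : ∀ i k, Measurable (B i k)) (i : Fin R) (k : ℕ)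
    {T : Set (SimIndex R)} (hT : SimIndex.geom i ∉ T) {E : Set Ω}
    (hE : MeasurableSet[blockSigma (simFamily M B N) T] E) :
    P.real ({ω | N i ω = k} ∩ E) = (1 - m.q) ^ k * m.q * P.real E := by
  have hF := measurable_simFamily hM hB h.measurable_geom
  have hind := indep_blockSigma (S := {SimIndex.geom i}) (T := T) hF h.indep (by simpa using hT)
  have hN : MeasurableSet[blockSigma (simFamily M B N) {SimIndex.geom i}] {ω | N i ω = k} :=
    measurableSet_geom_blockSigma (Set.mem_singleton _) k
  have hmul := (Indep_iff _ _ _).1 hind _ _ hN hE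
  rw [← h.law_geom i k, measureReal_def, measureReal_def, measureReal_def, hmul,
    ENNReal.toReal_mul]

lemma IsSimulation.measureReal_inter_lt_V (h : IsSimulation m P M B N)
    (hM : ∀ i k, Measurable (M i k)) (hB : ∀ i k, Measurable (B i k)) {i j : Fin R}
    (hij : i ≠ j) (u : ℝ) :
    P.real ({ω | u < V (M i) (B i) (N i) ω} ∩ {ω | u < V (M j) (B j) (N j) ω}) =
      P.real {ω | u < V (M i) (B i) (N i) ω} * P.real {ω | u < V (M j) (B j) (N j) ω} := by
  have hF := measurable_simFamily hM hB h.measurable_geom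
  have hind := indep_blockSigma (S := {s : SimIndex R | s.owner = i})
    (T := {s | s.owner = j}) hF h.indep (by
      rw [Set.disjoint_left]
      intro s (h1 : s.owner = i) (h2 : s.owner = j)
      exact hij (h1.symm.trans h2))
  have hmul := (Indep_iff _ _ _).1 hind _ _ (measurableSet_lt_V_blockSigma u)
    (measurableSet_lt_V_blockSigma u)
  rw [measureReal_def, measureReal_def, measureReal_def, hmul, ENNReal.toReal_mul]

lemma IsSimulation.measureReal_iInter_excess_le (h : IsSimulation m P M B N) (i : Fin R)
    [IsProbabilityMeasure m.htExcessLaw] (k : ℕ) (u : ℝ) :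
    P.real (⋂ j ∈ Finset.Icc 1 k, {ω | B i j ω ≤ u}) = (1 - tail m.htExcessLaw u) ^ k := by
  have hinj : Function.Injective fun j => (SimIndex.excess i j : SimIndex R) :=
    fun j l hjl => by simpa using hjl
  have h1 := (h.indep.precomp hinj).measure_inter_preimage_eq_mul (Finset.Icc 1 k)
    (sets := fun _ => Set.Iic u) (fun _ _ => measurableSet_Iic)
  have h2 : ∀ j, P.real {ω | B i j ω ≤ u} = 1 - tail m.htExcessLaw u := fun j => by
    rw [← real_Iic_eq]
    exact (h.law_excess i j).measureReal_eq (p := fun x => x ≤ u) measurableSet_Iic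
  have h3 := congrArg ENNReal.toReal h1
  rw [ENNReal.toReal_prod] at h3
  exact h3.trans ((Finset.prod_congr rfl fun j _ => h2 j).trans (by simp))

variable [IsProbabilityMeasure P]

lemma IsSimulation.hasSum_measureReal_lt_V (h : IsSimulation m P M B N)
    (hM : ∀ i k, Measurable (M i k)) (hB : ∀ i k, Measurable (B i k))
    [IsProbabilityMeasure m.discardSupLaw] [IsProbabilityMeasure m.htExcessLaw] (i : Fin R)
    (u : ℝ) :
    HasSum (fun k : ℕ => (1 - m.q) ^ k * m.q * tail (m.discardSupLaw.conv
      (convPow (m.discardSupLaw.conv m.htExcessLaw) (k + 2))) u)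
      (P.real {ω | u < V (M i) (B i) (N i) ω}) := by
  have hF := measurable_simFamily hM hB h.measurable_geom
  have hle : ∀ S, blockSigma (simFamily M B N) S ≤ (inferInstance : MeasurableSpace Ω) :=
    fun S => iSup₂_le fun s _ => (hF s).comap_le
  have hEk : ∀ k, MeasurableSet[blockSigma (simFamily M B N) (ladderIndices i (k + 2))]
      {ω | u < ladderSum (M i) (B i) (k + 2) ω} := fun k =>
    measurable_ladderSum_blockSigma (k := k + 2) subset_rfl measurableSet_Ioi
  have hterm : ∀ k, P.real ({ω | N i ω = k} ∩ {ω | u < ladderSum (M i) (B i) (k + 2) ω}) =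
      (1 - m.q) ^ k * m.q * tail (m.discardSupLaw.conv
        (convPow (m.discardSupLaw.conv m.htExcessLaw) (k + 2))) u := by
    intro k
    rw [h.measureReal_geom_inter hM hB i k (T := ladderIndices i (k + 2)) _ (hEk k)]
    · congr 1
      exact (h.hasLaw_ladderSum hM hB i (k + 2)).measureReal_eq (p := fun x => u < x)
        measurableSet_Ioi
    · rintro ⟨j, -, h | h⟩ <;> cases h
  simp_rw [← hterm]
  rw [setOf_lt_V_eq]
  have hmeas : ∀ k, MeasurableSet ({ω | N i ω = k} ∩
      {ω | u < ladderSum (M i) (B i) (k + 2) ω}) := fun k =>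
    ((h.measurable_geom i) (measurableSet_singleton k)).inter (hle _ _ (hEk k))
  have hdisj : Pairwise (Function.onFun Disjoint fun k => {ω | N i ω = k} ∩
      {ω | u < ladderSum (M i) (B i) (k + 2) ω}) := by
    intro k l hkl
    rw [Function.onFun, Set.disjoint_left]
    rintro ω ⟨h1, -⟩ ⟨h2, -⟩
    exact hkl (h1.symm.trans h2)
  have htop : ∑' k, P ({ω | N i ω = k} ∩ {ω | u < ladderSum (M i) (B i) (k + 2) ω}) ≠ ⊤ := by
    rw [← measure_iUnion hdisj hmeas]; exact measure_ne_top _ _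
  have hsum := ENNReal.hasSum_toReal htop
  rwa [← ENNReal.tsum_toReal_eq fun k => measure_ne_top _ _, ← measure_iUnion hdisj hmeas] at hsum

lemma IsSimulation.measureReal_lt_truncMax (h : IsSimulation m P M B N)
    (hM : ∀ i k, Measurable (M i k)) (hB : ∀ i k, Measurable (B i k))
    [IsProbabilityMeasure m.htExcessLaw] (i : Fin R) (n : ℕ) {u : ℝ} (hu : 0 ≤ u) :
    P.real {ω | u < truncMax n (B i) (N i) ω} = ∑ k ∈ Finset.range (n - 1),
      (1 - m.q) ^ k * m.q * (1 - (1 - tail m.htExcessLaw u) ^ (k + 2)) := by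
  have hF := measurable_simFamily hM hB h.measurable_geom
  have hE : ∀ k, MeasurableSet (⋂ j ∈ Finset.Icc 1 (k + 2), {ω | B i j ω ≤ u}) := fun k =>
    Finset.measurableSet_biInter _ fun j _ => hB i j measurableSet_Iic
  have hE' : ∀ k, MeasurableSet[blockSigma (simFamily M B N) (ladderIndices i (k + 2))]
      (⋂ j ∈ Finset.Icc 1 (k + 2), {ω | B i j ω ≤ u})ᶜ := by
    intro k
    have h1 : ∀ j ∈ Finset.Icc 1 (k + 2),
        MeasurableSet[blockSigma (simFamily M B N) (ladderIndices i (k + 2))]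
          {ω | B i j ω ≤ u} := fun j hj =>
      measurable_blockSigma (F := simFamily M B N) (S := ladderIndices i (k + 2))
        (s := SimIndex.excess i j) ⟨j, (Finset.mem_Icc.1 hj).2, Or.inr rfl⟩ measurableSet_Iic
    let _ : MeasurableSpace Ω := blockSigma (simFamily M B N) (ladderIndices i (k + 2))
    exact MeasurableSet.compl (Finset.measurableSet_biInter _ h1)
  rw [setOf_lt_truncMax_eq n _ _ hu, measureReal_biUnion_finset]
  · refine Finset.sum_congr rfl fun k _ => ?_
    rw [h.measureReal_geom_inter hM hB i k (T := ladderIndices i (k + 2)) _ (hE' k),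
      probReal_compl_eq_one_sub (hE k), h.measureReal_iInter_excess_le]
    rintro ⟨j, -, h | h⟩ <;> cases h
  · intro k _ l _ hkl
    rw [Function.onFun, Set.disjoint_left]
    rintro ω ⟨h1, -⟩ ⟨h2, -⟩
    exact hkl (h1.symm.trans h2)
  · exact fun k _ => ((h.measurable_geom i) (measurableSet_singleton k)).inter (hE k).compl

end Simulation

/-! ### Limits of the probabilities and of the variances -/

section Asymptotics

/-- A difference quotient at `0` of `x ↦ 1 - (1 - x) ^ k`, taken along `x = f u`. -/
lemma tendsto_one_sub_one_sub_pow_div {f : ℝ → ℝ} (hf : ∀ u, 0 < f u)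
    (hf0 : Tendsto f atTop (𝓝 0)) (k : ℕ) :
    Tendsto (fun u => (1 - (1 - f u) ^ k) / f u) atTop (𝓝 k) := by
  have hd : HasDerivAt (fun x : ℝ => 1 - (1 - x) ^ k) k 0 := by
    have := (((hasDerivAt_id (0 : ℝ)).const_sub 1).pow k).const_sub 1
    simpa using this
  have hlim : Tendsto f atTop (𝓝[≠] 0) :=
    tendsto_nhdsWithin_iff.2 ⟨hf0, Eventually.of_forall fun u => (hf u).ne'⟩
  refine ((hasDerivAt_iff_tendsto_slope.1 hd).comp hlim).congr fun u => ?_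
  simp [slope_def_field]

variable {m : MixtureModel}

/-- A union bound over the coordinates. All that the variance asymptotics need of the centring
constant is that it vanishes in the limit. -/
lemma MixtureModel.tendsto_approx (n : ℕ) [IsProbabilityMeasure m.htExcessLaw] :
    Tendsto (m.approx n) atTop (𝓝 0) := by
  unfold MixtureModel.approx
  have key : ∀ k ∈ Finset.Icc 2 n, Tendsto (fun u => m.p ^ k *
      (Measure.pi fun _ : Fin k => m.htExcessLaw).real {b | u < ⨆ j, b j}) atTop (𝓝 0) := by
    intro k hk
    have hk2 := (Finset.mem_Icc.1 hk).1
    have : Nonempty (Fin k) := ⟨⟨0, by omega⟩⟩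
    have hbound : ∀ u, (Measure.pi fun _ : Fin k => m.htExcessLaw).real {b | u < ⨆ j, b j} ≤
        k * tail m.htExcessLaw u := by
      intro u
      calc _ ≤ (Measure.pi fun _ : Fin k => m.htExcessLaw).real
            (⋃ j : Fin k, Function.eval j ⁻¹' Set.Ioi u) := by
            refine measureReal_mono fun b hb => ?_
            obtain ⟨j, hj⟩ := exists_lt_of_lt_ciSup (show u < ⨆ j, b j from hb)
            exact Set.mem_iUnion.2 ⟨j, hj⟩
        _ ≤ ∑ j : Fin k, (Measure.pi fun _ : Fin k => m.htExcessLaw).real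
            (Function.eval j ⁻¹' Set.Ioi u) := measureReal_iUnion_fintype_le _
        _ = ∑ _j : Fin k, tail m.htExcessLaw u := by
            refine Finset.sum_congr rfl fun j _ => ?_
            exact (measurePreserving_eval (fun _ : Fin k => m.htExcessLaw) j).measureReal_preimage
              measurableSet_Ioi.nullMeasurableSet
        _ = _ := by simp
    have hlim := (tendsto_tail_atTop m.htExcessLaw).const_mul (k : ℝ)
    rw [mul_zero] at hlim
    simpa using (squeeze_zero (fun u => measureReal_nonneg) hbound hlim).const_mul (m.p ^ k)
  simpa using (tendsto_finsetSum _ key).const_mul m.q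

lemma MixtureModel.hasSum_geom_mul [IsProbabilityMeasure m.htExcessLaw] :
    HasSum (fun k : ℕ => m.p ^ k * m.q * (k + 2)) ((1 + m.q) / m.q) := by
  have hp := m.p_pos
  have hq := m.q_pos
  have hpq := m.one_sub_q
  have hlt : ‖m.p‖ < 1 := by rw [Real.norm_of_nonneg hp.le]; exact m.p_lt_one
  have h1 := (hasSum_coe_mul_geometric_of_norm_lt_one hlt).add
    ((hasSum_geometric_of_norm_lt_one hlt).mul_left 2)
  have h2 := h1.mul_left m.q
  have hq' : 1 - m.p = m.q := by linarith
  rw [hq'] at h2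
  have h3 : m.q * (m.p / m.q ^ 2 + 2 * m.q⁻¹) = (1 + m.q) / m.q := by
    rw [← hpq]; field_simp; ring
  rw [h3] at h2
  exact h2.congr_fun fun k => by ring

/-- The sum of the first terms of `∑ k, p ^ k q (k + 2)`. -/
lemma MixtureModel.sum_geom_mul (n : ℕ) : (1 + m.q) / m.q -
    ∑ k ∈ Finset.range n, m.p ^ k * m.q * ((k : ℝ) + 2) =
      m.p ^ n * ((1 + (n + 1) * m.q) / m.q) := by
  have hq := m.q_pos
  induction n with
  | zero => simp
  | succ n ih =>
    rw [Finset.sum_range_succ, ← sub_sub, ih, pow_succ, ← m.one_sub_q]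
    push_cast
    field_simp
    ring

variable {Ω : Type*} {R : ℕ} [MeasurableSpace Ω] {P : Measure Ω} [IsProbabilityMeasure P]
  {M B : Fin R → ℕ → Ω → ℝ} {N : Fin R → Ω → ℕ}

/-- The probability that the target exceeds `u`, relative to the tail of the heavy-tailed
excess. -/
lemma IsSimulation.tendsto_measureReal_lt_V (h : IsSimulation m P M B N)
    (hsub : IsSubexponential m.htExcessLaw) [IsProbabilityMeasure m.discardSupLaw]
    (hM : ∀ i k, Measurable (M i k)) (hB : ∀ i k, Measurable (B i k)) (i : Fin R) :
    Tendsto (fun u => P.real {ω | u < V (M i) (B i) (N i) ω} / tail m.htExcessLaw u) atTop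
      (𝓝 ((1 + m.q) / m.q)) := by
  have := hsub.isProbabilityMeasure
  have hp := m.p_pos
  have hp1 := m.p_lt_one
  have hq := m.q_pos
  have hκ0 := m.discardSupLaw_Iio_zero
  have hκ := m.tendsto_tail_discardSupLaw hsub
  have hμ : Tendsto (fun u => tail m.htExcessLaw u / tail m.htExcessLaw u) atTop (𝓝 1) :=
    tendsto_const_nhds.congr fun u => (div_self (hsub.tail_pos u).ne').symm
  have hν0 := conv_Iio_zero hκ0 hsub.nonneg
  have hν := hsub.tendsto_tail_conv hκ0 hsub.nonneg hκ hμ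
  rw [zero_add] at hν
  set ν := m.discardSupLaw.conv m.htExcessLaw with hνdef
  have hlim := fun k => hsub.tendsto_tail_conv_convPow hν0 hκ0 hν hκ k
  -- Chosen so that `p * (1 + δ) = (p + 1) / 2 < 1`: Kesten's bound is then summable against the
  -- geometric weights.
  set δ : ℝ := (1 / m.p - 1) / 2 with hδ
  have hδ0 : 0 < δ := by
    have : 1 < 1 / m.p := by rw [lt_div_iff₀ hp]; linarith
    rw [hδ]; linarith
  have hpδ : m.p * (1 + δ) < 1 := by
    have : m.p * (1 + δ) = (m.p + 1) / 2 := by rw [hδ]; field_simp; ring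
    linarith
  obtain ⟨C, hC, hbound⟩ := hsub.tail_conv_convPow_le hν0 hν hκ hδ0
  have hsum : Summable fun k : ℕ => m.q * C * (1 + δ) ^ 2 * (m.p * (1 + δ)) ^ k :=
    (summable_geometric_of_lt_one (by positivity) hpδ).mul_left _
  have hdom := tendsto_tsum_of_dominated_convergence (𝓕 := atTop)
    (f := fun u (k : ℕ) => m.p ^ k * m.q *
      (tail (m.discardSupLaw.conv (convPow ν (k + 2))) u / tail m.htExcessLaw u))
    (g := fun k : ℕ => m.p ^ k * m.q * ((k : ℝ) + 2)) hsum
    (fun k => by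
      have := (hlim (k + 2)).const_mul (m.p ^ k * m.q)
      simpa using this)
    (by
      filter_upwards [eventually_ge_atTop 0] with u hu k
      have hF := hsub.tail_pos u
      have hT := tail_nonneg (m.discardSupLaw.conv (convPow ν (k + 2))) u
      rw [Real.norm_of_nonneg (by positivity)]
      have : tail (m.discardSupLaw.conv (convPow ν (k + 2))) u / tail m.htExcessLaw u ≤
          C * (1 + δ) ^ (k + 2) := (div_le_iff₀ hF).2 (hbound (k + 2) u hu)
      calc _ ≤ m.p ^ k * m.q * (C * (1 + δ) ^ (k + 2)) := by gcongr
        _ = _ := by rw [mul_pow]; ring)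
  rw [MixtureModel.hasSum_geom_mul.tsum_eq] at hdom
  refine hdom.congr fun u => ?_
  rw [← (h.hasSum_measureReal_lt_V hM hB i u).tsum_eq, ← tsum_div_const, m.one_sub_q]
  exact tsum_congr fun k => by rw [mul_div_assoc]

/-- The probability that the control exceeds `u`, relative to the tail of the heavy-tailed
excess. -/
lemma IsSimulation.tendsto_measureReal_lt_truncMax (h : IsSimulation m P M B N)
    (hsub : IsSubexponential m.htExcessLaw)
    (hM : ∀ i k, Measurable (M i k)) (hB : ∀ i k, Measurable (B i k)) (n : ℕ) (i : Fin R) :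
    Tendsto (fun u => P.real {ω | u < truncMax n (B i) (N i) ω} / tail m.htExcessLaw u) atTop
      (𝓝 (∑ k ∈ Finset.range (n - 1), m.p ^ k * m.q * ((k : ℝ) + 2))) := by
  have := hsub.isProbabilityMeasure
  have hterm : ∀ k ∈ Finset.range (n - 1), Tendsto (fun u => m.p ^ k * m.q *
      ((1 - (1 - tail m.htExcessLaw u) ^ (k + 2)) / tail m.htExcessLaw u)) atTop
      (𝓝 (m.p ^ k * m.q * ((k : ℝ) + 2))) := fun k _ => by
    have := (tendsto_one_sub_one_sub_pow_div hsub.tail_pos (tendsto_tail_atTop _)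
      (k + 2)).const_mul (m.p ^ k * m.q)
    simpa using this
  refine (tendsto_finsetSum _ hterm).congr' ?_
  filter_upwards [eventually_ge_atTop 0] with u hu
  rw [h.measureReal_lt_truncMax hM hB i n hu, Finset.sum_div, m.one_sub_q]
  exact Finset.sum_congr rfl fun k _ => by rw [mul_div_assoc]

lemma IsSimulation.tendsto_variance (h : IsSimulation m P M B N)
    (hsub : IsSubexponential m.htExcessLaw) {n : ℕ} (hn : 1 ≤ n) (hR : 2 ≤ R) :
    Tendsto (fun u => variance (cvEst m n M B N u) P / tail m.htExcessLaw u) atTop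
        (𝓝 (m.p ^ (n + 3) * ((1 + n * m.q) / m.q) / R)) ∧
      Tendsto (fun u => variance (crudeEst m M B N u) P / tail m.htExcessLaw u) atTop
        (𝓝 (m.p ^ 4 * ((1 + m.q) / m.q) / R)) := by
  have := hsub.isProbabilityMeasure
  have hκ : IsProbabilityMeasure m.discardSupLaw :=
    (h.law_sup ⟨0, by omega⟩ 0).isProbabilityMeasure_iff.1 inferInstance
  -- The inclusion of the control event in the target event needs pointwise nonnegativity; variances
  -- do not see the null set that is changed.
  obtain ⟨M', B', h', hM, hB, hM0, hB0, hae⟩ :=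
    h.exists_modification m.discardSupLaw_Iio_zero hsub.nonneg
  have hp := m.p_pos
  have hAm : ∀ u i, MeasurableSet {ω | u < V (M' i) (B' i) (N i) ω} := fun u i =>
    (iSup₂_le (f := fun s _ => MeasurableSpace.comap (simFamily M' B' N s) _) fun s _ =>
      (measurable_simFamily hM hB h.measurable_geom s).comap_le) _
      (measurableSet_lt_V_blockSigma u)
  have hA := h'.tendsto_measureReal_lt_V hsub hM hB
  have hf0 := tendsto_tail_atTop m.htExcessLaw
  constructor
  · have hcv := tendsto_variance_cvEstimator (P := P) (c := m.p ^ 2) hR (by positivity) hAm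
      (fun u i => measurableSet_lt measurable_const
        (measurable_truncMax (n := n) (hB i) (h.measurable_geom i)))
      (by
        filter_upwards [eventually_ge_atTop 0] with u hu i ω hω
        exact lt_V_of_lt_truncMax hu (fun k => hM0 i k ω) (fun k => hB0 i k ω) hω)
      (fun u i j hij => h'.measureReal_inter_lt_V hM hB hij u)
      (MixtureModel.tendsto_approx (m := m) n) hsub.tail_pos hf0 hA
      (h'.tendsto_measureReal_lt_truncMax hsub hM hB n)
    -- `N + 2 ≤ n` leaves the `n - 1` values `N < n - 1`, so what remains of the series starts at
    -- index `n - 1`.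
    obtain ⟨n, rfl⟩ : ∃ k, n = k + 1 := ⟨n - 1, by omega⟩
    rw [Nat.add_sub_cancel, MixtureModel.sum_geom_mul] at hcv
    convert hcv using 1
    · ext u
      congr 1
      refine variance_congr ?_
      filter_upwards [hae] with ω hω
      exact cvEstimator_congr _ (target_congr u hω) (control_congr _ u fun i k => (hω i k).2)
    · congr 1; push_cast; ring
  -- With empty control events the coefficient is `0`, and the estimator is the crude one.
  · have hcv := tendsto_variance_cvEstimator (P := P) (c := m.p ^ 2) (D := fun _ _ => ∅)
      (y := fun _ => 0) (β := 0) hR (by positivity) hAm (fun _ _ => MeasurableSet.empty)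
      (Eventually.of_forall fun _ _ => Set.empty_subset _)
      (fun u i j hij => h'.measureReal_inter_lt_V hM hB hij u)
      tendsto_const_nhds hsub.tail_pos hf0 hA (by simp)
    convert hcv using 1
    · ext u
      congr 1
      refine variance_congr ?_
      filter_upwards [hae] with ω hω
      rw [cvEstimator_eq_empMean (by simp)]
      simp only [crudeEst, empMean, target_congr u hω]
      rfl
    · congr 1; ring

end Asymptotics

end RuinCV

theorem mainTheorem1 (m : RuinCV.MixtureModel) (hsub : RuinCV.IsSubexponential m.htExcessLaw)
    (n : ℕ) (hn : 1 ≤ n) (R : ℕ) (hR : 2 ≤ R)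
    {Ω : Type*} [MeasurableSpace Ω] (P : Measure Ω) [IsProbabilityMeasure P]
    (M B : Fin R → ℕ → Ω → ℝ) (N : Fin R → Ω → ℕ) (hsim : RuinCV.IsSimulation m P M B N) :
    (fun u : ℝ => variance (RuinCV.cvEst m n M B N u) P) ~[atTop]
        (fun u : ℝ => m.p ^ (n + 3) * ((1 + n * m.q) / m.q) *
          (RuinCV.tail m.htExcessLaw u / R)) ∧
      Tendsto
        (fun u : ℝ => variance (RuinCV.cvEst m n M B N u) P /
          variance (RuinCV.crudeEst m M B N u) P)
        atTop (𝓝 (m.p ^ (n - 1) * ((1 + n * m.q) / (1 + m.q)))) := by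
  have := hsub.isProbabilityMeasure
  have hp := m.p_pos
  have hq := m.q_pos
  have hR' : (0 : ℝ) < R := by exact_mod_cast (by omega : 0 < R)
  obtain ⟨h1, h2⟩ := hsim.tendsto_variance hsub hn hR
  set L : ℝ := m.p ^ (n + 3) * ((1 + n * m.q) / m.q) with hL
  have hL0 : 0 < L := by positivity
  constructor
  · rw [isEquivalent_iff_tendsto_one (Eventually.of_forall fun u => by
      have := hsub.tail_pos u; positivity)]
    have h3 := h1.div_const (L / R)
    rw [div_self (by positivity)] at h3
    refine h3.congr fun u => ?_
    have := (hsub.tail_pos u).ne'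
    simp only [Pi.div_apply]
    field_simp
  · have h3 := h1.div h2 (by positivity)
    have hlim : L / R / (m.p ^ 4 * ((1 + m.q) / m.q) / R) =
        m.p ^ (n - 1) * ((1 + n * m.q) / (1 + m.q)) := by
      obtain ⟨n, rfl⟩ : ∃ k, n = k + 1 := ⟨n - 1, by omega⟩
      rw [hL, Nat.add_sub_cancel, show n + 1 + 3 = n + 4 by ring, pow_add]
      field_simp
    rw [hlim] at h3
    refine h3.congr fun u => ?_
    simp only [Pi.div_apply]
    rw [div_div_div_cancel_right₀ (hsub.tail_pos u).ne']
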